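/- Let $\mathcal Q_2$ be the universal unital $C^*$-algebra generated by a unitary $u$ and an isometry $s_2$ subject to $s_2u=u^2s_2$ and $s_2s_2^*+us_2s_2^*u^{-1}=1$. For $i\in\mathbb N_0$ put $e_{2^i}=s_2^i(s_2^i)^*$, and let $\mathcal D\subseteq\mathcal Q_2$ be the $C^*$-subalgebra generated by the projections $u^le_{2^i}u^{-l}$ ($l\in\mathbb Z$, $i\in\mathbb N_0$). Let $\mathbb Z\rtimes[2\rangle$ be the semigroup of pairs $(l,2^i)$ with $l\in\mathbb Z$, $i\in\mathbb N_0$ and product $(l,2^i)(n,2^j)=(l+2^in,2^{i+j})$. It acts on $\mathcal D$ by the endomorphisms $\alpha_{(l,2^i)}(f)=u^ls_2^i\,f\,(u^ls_2^i)^*$, and on $C(\mathbb Z_2)$, the continuous complex functions on the $2$-adic integers, by $$\alpha^{\mathrm{aff}}_{(l,2^i)}(f)(z)=\begin{cases}f(2^{-i}(z-l)),& z\in l+2^i\mathbb Z_2,\\ 0,&\text{otherwise.}\end{cases}$$ For an action $\alpha$ of a monoid $P$ by (not necessarily unital) endomorphisms of a unital $C^*$-algebra $D$, the semigroup crossed product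 $D\rtimes_\alpha P$ is the universal $C^*$-algebra for pairs $(\pi,W)$ consisting of a unital representation $\pi$ of $D$ on a Hilbert space and an identity-preserving homomorphism $W$ of $P$ into the isometries on the same space, such that $\pi(\alpha_p(a))=W_p\pi(a)W_p^*$ for all $p\in P$, $a\in D$; its canonical isometries are denoted $w_p$. Then: 1. $\mathcal D$ is commutative. There is a homeomorphism $\sigma$ from $\mathbb Z_2$ onto the spectrum (character space) of $\mathcal D$ such that the Gelfand transform composed with $\sigma$, i.e. $\Gamma(a)(z)=\sigma(z)(a)$, is a $*$-isomorphism $\Gamma:\mathcal D\to C(\mathbb Z_2)$. It satisfies $\Gamma(u^le_{2^i}u^{-l})=\mathbb 1_{l+2^i\mathbb Z_2}$ for all $l\in\mathbb Z$, $i\in\mathbb N_0$, and $\Gamma\circ\alpha_p=\alpha^{\mathrm{aff}}_p\circ\Gamma$ for all $p\in\mathbb Z\rtimes[2\rangle$. 2. There is a $*$-isomorphism $\mathcal Q_2\to\mathcal D\rtimes_\alpha(\mathbb Z\rtimes[2\rangle)$ with $u^ls_2^i\mapsto w_{(l,2^i)}$ for all $l\in\mathbb Z$, $i\in\mathbb N_0$.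 3. There is a $*$-isomorphism $\mathcal Q_2\to C(\mathbb Z_2)\rtimes_{\alpha^{\mathrm{aff}}}(\mathbb Z\rtimes[2\rangle)$ with $s_2\mapsto w_{(0,2)}$ and $u\mapsto w_{(1,1)}$. -/

import Mathlib

open scoped ENNReal

universe u v w w₁ w₂

noncomputable section

/-- The bounded families in a product of nonzero unital C⋆-algebras form a unital C⋆-algebra. -/
instance lpInftyCStarAlgebra {I : Type u} {A : I → Type v} [∀ i, Nontrivial (A i)]
    [∀ i, CStarAlgebra (A i)] : CStarAlgebra (lp A ∞) where

/-- Closed star subalgebras given as a topological closure are C⋆-algebras. -/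
instance topologicalClosureCStarAlgebra {A : Type u} [CStarAlgebra A] (S : StarSubalgebra ℂ A) :
    CStarAlgebra S.topologicalClosure :=
  StarSubalgebra.cstarAlgebra _ (h_closed := S.isClosed_topologicalClosure)

theorem norm_le_one_of_star_mul_self {A : Type u} [CStarAlgebra A] {a : A}
    (h : star a * a = 1) : ‖a‖ ≤ 1 := by
  have h1 : ‖a‖ * ‖a‖ = ‖(1 : A)‖ := by rw [← CStarRing.norm_star_mul_self, h]
  rcases subsingleton_or_nontrivial A with hA | hA
  · rw [Subsingleton.elim a 0, norm_zero]; exact zero_le_one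
  · rw [CStarRing.norm_one] at h1
    nlinarith [norm_nonneg a]

/-- If conjugation by an isometry maps generators into the generated C⋆-algebra `S`, and the range
projection lies in `S`, then conjugation maps `S` into itself. -/
theorem conj_mem_topologicalClosure {A : Type u} [CStarAlgebra A] {v : A} (hv : star v * v = 1)
    {X : Set A} (h1 : v * star v ∈ StarAlgebra.adjoin ℂ X)
    (hX : ∀ x ∈ X, v * x * star v ∈ StarAlgebra.adjoin ℂ X) {x : A}
    (hx : x ∈ (StarAlgebra.adjoin ℂ X).topologicalClosure) :
    v * x * star v ∈ (StarAlgebra.adjoin ℂ X).topologicalClosure := by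
  have key : ∀ y ∈ StarAlgebra.adjoin ℂ X, v * y * star v ∈ StarAlgebra.adjoin ℂ X := by
    intro y hy
    induction hy using StarAlgebra.adjoin_induction with
    | mem y hy => exact hX y hy
    | algebraMap r =>
      rw [Algebra.algebraMap_eq_smul_one, mul_smul_comm, mul_one, smul_mul_assoc]
      exact SMulMemClass.smul_mem r h1
    | add a b _ _ ha hb => rw [mul_add, add_mul]; exact add_mem ha hb
    | mul a b _ _ ha hb =>
      have h := mul_mem ha hb
      have e : v * a * star v * (v * b * star v) = v * a * (star v * v) * b * star v := by
        simp only [mul_assoc]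
      rw [e, hv, mul_one] at h
      rwa [← mul_assoc v a b]
    | star a _ ha =>
      have h := star_mem ha
      rwa [star_mul, star_mul, star_star, ← mul_assoc] at h
  exact map_mem_closure (f := fun y : A => v * y * star v)
    ((continuous_const.mul continuous_id).mul continuous_const) hx key

/-- The endomorphism `x ↦ v x v*` of a star subalgebra `S` that is invariant under it, for an
isometry `v`. -/
def conjEnd {A : Type u} [CStarAlgebra A] (S : StarSubalgebra ℂ A) (v : A) (hv : star v * v = 1)
    (hS : ∀ x ∈ S, v * x * star v ∈ S) : S →⋆ₙₐ[ℂ] S where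
  toFun x := ⟨v * x * star v, hS x x.2⟩
  map_smul' c x := Subtype.ext (by simp)
  map_zero' := Subtype.ext (by simp)
  map_add' x y := Subtype.ext (by simp [mul_add, add_mul])
  map_mul' x y := Subtype.ext (by
    change v * ((x : A) * y) * star v = v * x * star v * (v * y * star v)
    rw [show v * (x : A) * star v * (v * y * star v) = v * x * (star v * v) * y * star v by
      simp only [mul_assoc], hv, mul_one]
    simp only [mul_assoc])
  map_star' x := Subtype.ext (by
    change v * star (x : A) * star v = star (v * x * star v)
    simp only [star_mul, star_star, mul_assoc])

/-! ### The C⋆-algebra `Q₂` -/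

/-- A representation, on a nonzero Hilbert space, of the relations defining `Q₂`: a unitary `U` and
an isometry `S` with `S U = U² S` and `S S* + U S S* U⁻¹ = 1`. -/
structure Q2Rep : Type (w + 1) where
  /-- The Hilbert space. -/
  H : Type w
  [normed : NormedAddCommGroup H]
  [inner : InnerProductSpace ℂ H]
  [complete : CompleteSpace H]
  [nontrivial : Nontrivial H]
  /-- The unitary. -/
  U : unitary (H →L[ℂ] H)
  /-- The isometry. -/
  S : H →L[ℂ] H
  isometry : star S * S = 1
  rel_one : S * U = ((U ^ 2 : unitary (H →L[ℂ] H)) : H →L[ℂ] H) * S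
  rel_two : S * star S + U * (S * star S) * ((U⁻¹ : unitary (H →L[ℂ] H)) : H →L[ℂ] H) = 1

attribute [instance] Q2Rep.normed Q2Rep.inner Q2Rep.complete Q2Rep.nontrivial

namespace Q2

/-- The C⋆-algebra of bounded families of operators, indexed by all representations of the
relations. -/
def Ambient : Type (w + 1) := lp (fun ρ : Q2Rep.{w} => ρ.H →L[ℂ] ρ.H) ∞

/-- The pointwise C⋆-algebra structure, with the supremum norm. -/
def Ambient.cstar : CStarAlgebra Ambient.{w} :=
  lpInftyCStarAlgebra (A := fun ρ : Q2Rep.{w} => ρ.H →L[ℂ] ρ.H)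

instance : CStarAlgebra Ambient.{w} := Ambient.cstar

/-- The family of all the unitaries `U`. -/
def univU : Ambient.{w} :=
  ⟨fun ρ => ρ.U, memℓp_infty ⟨1, by
    rintro _ ⟨ρ, rfl⟩
    exact norm_le_one_of_star_mul_self (Unitary.coe_star_mul_self ρ.U)⟩⟩

/-- The family of all the isometries `S`. -/
def univS : Ambient.{w} :=
  ⟨fun ρ => ρ.S, memℓp_infty ⟨1, by
    rintro _ ⟨ρ, rfl⟩
    exact norm_le_one_of_star_mul_self ρ.isometry⟩⟩

/-- The C⋆-subalgebra generated by the two families. -/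
def carrier : StarSubalgebra ℂ Ambient.{w} :=
  (StarAlgebra.adjoin ℂ {univU, univS}).topologicalClosure

end Q2

/-- The universal unital C⋆-algebra `Q₂` generated by a unitary `u` and an isometry `s₂` subject to
`s₂ u = u² s₂` and `s₂ s₂* + u s₂ s₂* u⁻¹ = 1`, realised as the C⋆-algebra generated by the direct
sum of all representations of these relations (on Hilbert spaces in the universe `w`). -/
def Q2 : Type (w + 1) := Q2.carrier.{w}

/-- The C⋆-algebra structure of `Q₂`, inherited from the direct sum. -/
def Q2.cstar : CStarAlgebra Q2.{w} :=
  topologicalClosureCStarAlgebra (StarAlgebra.adjoin ℂ {Q2.univU.{w}, Q2.univS.{w}})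

instance : CStarAlgebra Q2.{w} := Q2.cstar

namespace Q2

/-- Every representation of the relations defines a representation of `Q₂`. -/
def rep (ρ : Q2Rep.{w}) : Q2.{w} →⋆ₐ[ℂ] (ρ.H →L[ℂ] ρ.H) where
  toFun x := x.1.1 ρ
  map_one' := rfl
  map_mul' _ _ := rfl
  map_zero' := rfl
  map_add' _ _ := rfl
  commutes' _ := rfl
  map_star' _ := rfl

theorem ext_rep {x y : Q2.{w}} (h : ∀ ρ, rep ρ x = rep ρ y) : x = y :=
  Subtype.ext (Subtype.ext (funext h))

/-- The canonical isometry `s₂` of `Q₂`. -/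
def s : Q2.{w} :=
  ⟨univS, StarSubalgebra.le_topologicalClosure _ (StarAlgebra.subset_adjoin ℂ _ (by simp))⟩

/-- The generator `u` of `Q₂`, as an element. -/
def uElt : Q2.{w} :=
  ⟨univU, StarSubalgebra.le_topologicalClosure _ (StarAlgebra.subset_adjoin ℂ _ (by simp))⟩

theorem rep_s (ρ : Q2Rep.{w}) : rep ρ s = ρ.S := rfl

theorem rep_uElt (ρ : Q2Rep.{w}) : rep ρ uElt = ρ.U := rfl

/-- The canonical unitary `u` of `Q₂`. -/
def u : unitary Q2.{w} :=
  ⟨uElt, by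
    rw [Unitary.mem_iff]
    constructor <;> refine ext_rep fun ρ => ?_ <;>
      rw [map_mul, map_star, map_one, rep_uElt]
    · exact Unitary.coe_star_mul_self ρ.U
    · exact Unitary.coe_mul_star_self ρ.U⟩

theorem rep_u (ρ : Q2Rep.{w}) : rep ρ (u : Q2.{w}) = ρ.U := rfl

theorem star_s_mul_s : star s * s = (1 : Q2.{w}) := by
  refine ext_rep fun ρ => ?_
  rw [map_mul, map_star, map_one, rep_s]
  exact ρ.isometry

theorem s_mul_u : s * (u : Q2.{w}) = ((u ^ 2 : unitary Q2.{w}) : Q2.{w}) * s := by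
  refine ext_rep fun ρ => ?_
  rw [map_mul, map_mul, SubmonoidClass.coe_pow, map_pow, rep_s, rep_u]
  exact ρ.rel_one

theorem s_range_sum :
    s * star s + u * (s * star s) * ((u⁻¹ : unitary Q2.{w}) : Q2.{w}) = 1 := by
  refine ext_rep fun ρ => ?_
  rw [← Unitary.star_eq_inv, Unitary.coe_star]
  simp only [map_add, map_mul, map_star, map_one, rep_s, rep_u]
  exact ρ.rel_two

end Q2

/-! ### The semigroup `ℤ ⋊ [2⟩` -/

/-- The semigroup `ℤ ⋊ [2⟩`, where `[2⟩ = {1, 2, 4, …}` acts on `ℤ` by multiplication.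
The pair `⟨l, i⟩` stands for the element `(l, 2 ^ i)`. -/
@[ext]
structure AffSemigroup : Type where
  /-- The translation part. -/
  l : ℤ
  /-- The exponent of the dilation part `2 ^ i`. -/
  i : ℕ

namespace AffSemigroup

/-- `(l, 2 ^ i) (n, 2 ^ j) = (l + 2 ^ i n, 2 ^ (i + j))`. -/
instance : Mul AffSemigroup := ⟨fun p q => ⟨p.l + 2 ^ p.i * q.l, p.i + q.i⟩⟩

/-- The identity element `(0, 1)`. -/
instance : One AffSemigroup := ⟨⟨0, 0⟩⟩

@[simp] theorem mul_l (p q : AffSemigroup) : (p * q).l = p.l + 2 ^ p.i * q.l := rfl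
@[simp] theorem mul_i (p q : AffSemigroup) : (p * q).i = p.i + q.i := rfl
@[simp] theorem one_l : (1 : AffSemigroup).l = 0 := rfl
@[simp] theorem one_i : (1 : AffSemigroup).i = 0 := rfl

instance : Monoid AffSemigroup where
  mul_assoc p q r := by
    ext
    · simp only [mul_l, mul_i, pow_add]; ring
    · simp only [mul_i]; ring
  one_mul p := by ext <;> simp
  mul_one p := by ext <;> simp

end AffSemigroup

/-! ### Semigroup crossed products -/

/-- A covariant pair `(π, W)` on a nonzero Hilbert space, for an action `α` of a monoid `P` by (not
necessarily unital) endomorphisms of a unital C⋆-algebra `D`: a unital representation `π` of `D`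
and a homomorphism `W` from `P` to the isometries, with `π (α_p a) = W_p π(a) W_p*`. -/
structure CovariantRep {D : Type u} [CStarAlgebra D] {P : Type v} [Monoid P]
    (α : P →* (D →⋆ₙₐ[ℂ] D)) : Type (max u v (w + 1)) where
  /-- The Hilbert space. -/
  H : Type w
  [normed : NormedAddCommGroup H]
  [inner : InnerProductSpace ℂ H]
  [complete : CompleteSpace H]
  [nontrivial : Nontrivial H]
  /-- The representation of the algebra. -/
  π : D →⋆ₐ[ℂ] (H →L[ℂ] H)
  /-- The representation of the monoid. -/
  W : P →* (H →L[ℂ] H)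
  isometry : ∀ p, star (W p) * W p = 1
  covariant : ∀ p a, π (α p a) = W p * π a * star (W p)

attribute [instance] CovariantRep.normed CovariantRep.inner CovariantRep.complete
  CovariantRep.nontrivial

namespace SemigroupCrossedProduct

section

variable {D : Type u} [CStarAlgebra D] {P : Type v} [Monoid P] (α : P →* (D →⋆ₙₐ[ℂ] D))

/-- The C⋆-algebra of bounded families of operators, indexed by all covariant pairs on Hilbert
spaces in the universe `w`. -/
def Ambient : Type (max u v (w + 1)) :=
  lp (fun ρ : CovariantRep.{u, v, w} α => ρ.H →L[ℂ] ρ.H) ∞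

/-- The pointwise C⋆-algebra structure, with the supremum norm. -/
def Ambient.cstar : CStarAlgebra (Ambient.{u, v, w} α) :=
  lpInftyCStarAlgebra (A := fun ρ : CovariantRep.{u, v, w} α => ρ.H →L[ℂ] ρ.H)

instance : CStarAlgebra (Ambient.{u, v, w} α) := Ambient.cstar α

/-- The family of all the operators `π a`. -/
def univRep (a : D) : Ambient.{u, v, w} α :=
  ⟨fun ρ => ρ.π a, memℓp_infty ⟨‖a‖, by
    rintro _ ⟨ρ, rfl⟩
    exact NonUnitalStarAlgHom.norm_apply_le ρ.π a⟩⟩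

/-- The family of all the isometries `W p`. -/
def univIsom (p : P) : Ambient.{u, v, w} α :=
  ⟨fun ρ => ρ.W p, memℓp_infty ⟨1, by
    rintro _ ⟨ρ, rfl⟩
    exact norm_le_one_of_star_mul_self (ρ.isometry p)⟩⟩

/-- The C⋆-subalgebra generated by the families `π a` and `W p`. -/
def carrier : StarSubalgebra ℂ (Ambient.{u, v, w} α) :=
  (StarAlgebra.adjoin ℂ
    (Set.range (univRep.{u, v, w} α) ∪ Set.range (univIsom.{u, v, w} α))).topologicalClosure

end

end SemigroupCrossedProduct

/-- The semigroup crossed product of `D` by `P`, i.e. the universal C⋆-algebra for covariant pairs,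
realised as the C⋆-algebra generated by the direct sum of all covariant pairs (on Hilbert spaces in
the universe `w`). -/
def SemigroupCrossedProduct {D : Type u} [CStarAlgebra D] {P : Type v} [Monoid P]
    (α : P →* (D →⋆ₙₐ[ℂ] D)) : Type (max u v (w + 1)) :=
  SemigroupCrossedProduct.carrier.{u, v, w} α

namespace SemigroupCrossedProduct

section

variable {D : Type u} [CStarAlgebra D] {P : Type v} [Monoid P] (α : P →* (D →⋆ₙₐ[ℂ] D))

/-- The C⋆-algebra structure of the crossed product, inherited from the direct sum. -/
def cstar : CStarAlgebra (SemigroupCrossedProduct.{u, v, w} α) :=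
  topologicalClosureCStarAlgebra (StarAlgebra.adjoin ℂ
    (Set.range (univRep.{u, v, w} α) ∪ Set.range (univIsom.{u, v, w} α)))

instance : CStarAlgebra (SemigroupCrossedProduct.{u, v, w} α) := cstar α

/-- Every covariant pair defines a representation of the crossed product. -/
def rep (ρ : CovariantRep.{u, v, w} α) :
    SemigroupCrossedProduct.{u, v, w} α →⋆ₐ[ℂ] (ρ.H →L[ℂ] ρ.H) where
  toFun x := x.1.1 ρ
  map_one' := rfl
  map_mul' _ _ := rfl
  map_zero' := rfl
  map_add' _ _ := rfl
  commutes' _ := rfl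
  map_star' _ := rfl

variable {α} in
theorem ext_rep {x y : SemigroupCrossedProduct.{u, v, w} α} (h : ∀ ρ, rep α ρ x = rep α ρ y) :
    x = y :=
  Subtype.ext (Subtype.ext (funext h))

/-- The element `ι a` of the crossed product. -/
def ιElt (a : D) : SemigroupCrossedProduct.{u, v, w} α :=
  ⟨univRep α a, StarSubalgebra.le_topologicalClosure _
    (StarAlgebra.subset_adjoin ℂ _ (Or.inl ⟨a, rfl⟩))⟩

/-- The element `w_p` of the crossed product. -/
def isomElt (p : P) : SemigroupCrossedProduct.{u, v, w} α :=
  ⟨univIsom α p, StarSubalgebra.le_topologicalClosure _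
    (StarAlgebra.subset_adjoin ℂ _ (Or.inr ⟨p, rfl⟩))⟩

theorem rep_ιElt (ρ : CovariantRep.{u, v, w} α) (a : D) : rep α ρ (ιElt α a) = ρ.π a := rfl

theorem rep_isomElt (ρ : CovariantRep.{u, v, w} α) (p : P) : rep α ρ (isomElt α p) = ρ.W p := rfl

/-- The canonical homomorphism from `D` to the crossed product. -/
def ι : D →⋆ₐ[ℂ] SemigroupCrossedProduct.{u, v, w} α where
  toFun a := ιElt α a
  map_one' := ext_rep fun ρ => by simp only [rep_ιElt, map_one]
  map_zero' := ext_rep fun ρ => by simp only [rep_ιElt, map_zero]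
  map_mul' a b := ext_rep fun ρ => by simp only [rep_ιElt, map_mul]
  map_add' a b := ext_rep fun ρ => by simp only [rep_ιElt, map_add]
  map_star' a := ext_rep fun ρ => by simp only [rep_ιElt, map_star]
  commutes' c := ext_rep fun ρ => by simp only [rep_ιElt, AlgHomClass.commutes]

/-- The canonical isometries `w_p` of the crossed product, which implement `α`. -/
def isom : P →* SemigroupCrossedProduct.{u, v, w} α where
  toFun p := isomElt α p
  map_one' := ext_rep fun ρ => by simp only [rep_isomElt, map_one]
  map_mul' p q := ext_rep fun ρ => by simp only [rep_isomElt, map_mul]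

theorem rep_ι (ρ : CovariantRep.{u, v, w} α) (a : D) : rep α ρ (ι α a) = ρ.π a := rfl

theorem rep_isom (ρ : CovariantRep.{u, v, w} α) (p : P) : rep α ρ (isom α p) = ρ.W p := rfl

theorem star_isom_mul_isom (p : P) :
    star (isom.{u, v, w} α p) * isom.{u, v, w} α p = 1 := by
  refine ext_rep fun ρ => ?_
  rw [map_mul, map_star, map_one, rep_isom]
  exact ρ.isometry p

theorem ι_covariant (p : P) (a : D) :
    ι.{u, v, w} α (α p a) = isom α p * ι α a * star (isom α p) := by
  refine ext_rep fun ρ => ?_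
  rw [map_mul, map_mul, map_star, rep_ι, rep_ι, rep_isom]
  exact ρ.covariant p a

end

end SemigroupCrossedProduct

/-! ### The diagonal subalgebra and its action -/

namespace Q2

/-- The projection `e_{2^i} = s₂ ^ i (s₂ ^ i)*`. -/
def e (i : ℕ) : Q2.{w} := s ^ i * star (s ^ i)

/-- The projection `u ^ l e_{2^i} u ^ (-l)`. -/
def proj (l : ℤ) (i : ℕ) : Q2.{w} :=
  ((u ^ l : unitary Q2.{w}) : Q2.{w}) * e i * ((u ^ (-l) : unitary Q2.{w}) : Q2.{w})

/-- The diagonal subalgebra: the C⋆-subalgebra of `Q₂` generated by all `u ^ l e_{2^i} u ^ (-l)`. -/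
def diag : StarSubalgebra ℂ Q2.{w} :=
  (StarAlgebra.adjoin ℂ {x : Q2.{w} | ∃ l i, x = proj l i}).topologicalClosure

instance : CStarAlgebra diag.{w} :=
  StarSubalgebra.cstarAlgebra _ (h_closed := StarSubalgebra.isClosed_topologicalClosure _)

/-- The projection `u ^ l e_{2^i} u ^ (-l)` as an element of the diagonal subalgebra. -/
def diagProj (l : ℤ) (i : ℕ) : diag.{w} :=
  ⟨proj l i, StarSubalgebra.le_topologicalClosure _ (StarAlgebra.subset_adjoin ℂ _ ⟨l, i, rfl⟩)⟩

theorem s_mul_u_zpow (l : ℤ) :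
    s * ((u ^ l : unitary Q2.{w}) : Q2.{w}) = ((u ^ (2 * l) : unitary Q2.{w}) : Q2.{w}) * s := by
  have h : SemiconjBy (s : Q2.{w}) (Unitary.toUnits u : Q2.{w}ˣ) (Unitary.toUnits (u ^ 2)) := by
    exact s_mul_u
  have h2 := h.units_zpow_right l
  rw [← map_zpow, ← map_zpow, ← zpow_natCast, ← zpow_mul] at h2
  exact h2

theorem s_pow_mul_u_zpow (i : ℕ) (l : ℤ) :
    s ^ i * ((u ^ l : unitary Q2.{w}) : Q2.{w}) =
      ((u ^ (2 ^ i * l) : unitary Q2.{w}) : Q2.{w}) * s ^ i := by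
  induction i generalizing l with
  | zero => simp
  | succ i ih =>
    rw [pow_succ, mul_assoc, s_mul_u_zpow, ← mul_assoc, ih, mul_assoc,
      show (2 : ℤ) ^ i * (2 * l) = 2 ^ (i + 1) * l by ring]

/-- The isometries `u ^ l s₂ ^ i` of `Q₂`, as a homomorphism on `ℤ ⋊ [2⟩`. -/
def mono : AffSemigroup →* Q2.{w} where
  toFun p := ((u ^ p.l : unitary Q2.{w}) : Q2.{w}) * s ^ p.i
  map_one' := by simp
  map_mul' p q := by
    rw [AffSemigroup.mul_l, AffSemigroup.mul_i, zpow_add, pow_add, mul_assoc, ← mul_assoc (s ^ p.i),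
      s_pow_mul_u_zpow]
    simp only [Submonoid.coe_mul, mul_assoc]

theorem mono_apply (p : AffSemigroup) :
    mono.{w} p = ((u ^ p.l : unitary Q2.{w}) : Q2.{w}) * s ^ p.i := rfl

theorem star_s_pow_mul (i : ℕ) : star (s ^ i) * s ^ i = (1 : Q2.{w}) := by
  induction i with
  | zero => simp
  | succ i ih =>
    rw [pow_succ', star_mul, mul_assoc, ← mul_assoc (star s), star_s_mul_s, one_mul, ih]

theorem star_mono_mul (p : AffSemigroup) : star (mono p) * mono p = (1 : Q2.{w}) := by
  rw [mono_apply, star_mul, mul_assoc, ← mul_assoc (star _) _ (s ^ p.i), Unitary.coe_star_mul_self,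
    one_mul, star_s_pow_mul]

theorem proj_eq (l : ℤ) (i : ℕ) : proj.{w} l i = mono ⟨l, i⟩ * star (mono ⟨l, i⟩) := by
  rw [proj, e, mono_apply, star_mul, zpow_neg, ← Unitary.star_eq_inv, Unitary.coe_star]
  simp only [mul_assoc]

theorem mono_conj_mem (p : AffSemigroup) (x : Q2.{w}) (hx : x ∈ diag.{w}) :
    mono p * x * star (mono p) ∈ diag.{w} := by
  have hr (q : AffSemigroup) : mono q * star (mono q) ∈
      StarAlgebra.adjoin ℂ {x : Q2.{w} | ∃ l i, x = proj l i} :=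
    StarAlgebra.subset_adjoin ℂ _ ⟨q.l, q.i, (proj_eq q.l q.i).symm⟩
  refine conj_mem_topologicalClosure (star_mono_mul p) (hr p) ?_ hx
  rintro _ ⟨l, i, rfl⟩
  have h := hr (p * ⟨l, i⟩)
  rw [map_mul, star_mul] at h
  rw [proj_eq]
  simpa only [mul_assoc] using h

/-- The endomorphism `Ad(u ^ l s₂ ^ i)` of the diagonal subalgebra. -/
def diagAd (p : AffSemigroup) : diag.{w} →⋆ₙₐ[ℂ] diag.{w} :=
  conjEnd diag (mono p) (star_mono_mul p) (mono_conj_mem p)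

/-- The action `α` of `ℤ ⋊ [2⟩` on the diagonal subalgebra, `α_(l, 2^i) = Ad(u ^ l s₂ ^ i)`. -/
def diagAction : AffSemigroup →* (diag.{w} →⋆ₙₐ[ℂ] diag.{w}) where
  toFun := diagAd
  map_one' := by
    ext x
    change mono 1 * (x : Q2.{w}) * star (mono 1) = x
    simp
  map_mul' p q := by
    ext x
    change mono (p * q) * (x : Q2.{w}) * star (mono (p * q)) =
      mono p * (mono q * x * star (mono q)) * star (mono p)
    simp only [map_mul, star_mul, mul_assoc]

end Q2

/-! ### The affine action on `C(ℤ₂)` -/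

namespace TwoAdic

/-- The affine map `z ↦ l + 2 ^ i z` of `ℤ₂`. -/
def aff (p : AffSemigroup) (z : ℤ_[2]) : ℤ_[2] := (p.l : ℤ_[2]) + 2 ^ p.i * z

theorem aff_injective (p : AffSemigroup) : Function.Injective (aff p) := by
  intro x y h
  have h1 : (2 : ℤ_[2]) ^ p.i * x = 2 ^ p.i * y := add_left_cancel h
  exact mul_left_cancel₀ (pow_ne_zero _ two_ne_zero) h1

theorem aff_mul (p q : AffSemigroup) (z : ℤ_[2]) : aff (p * q) z = aff p (aff q z) := by
  simp only [aff, AffSemigroup.mul_l, AffSemigroup.mul_i]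
  push_cast
  ring

/-- The coset `l + 2 ^ i ℤ₂`. -/
def coset (l : ℤ) (i : ℕ) : Set ℤ_[2] := {z | ∃ y : ℤ_[2], z = (l : ℤ_[2]) + 2 ^ i * y}

theorem isClopen_coset (l : ℤ) (i : ℕ) : IsClopen (coset l i) := by
  have h : coset l i = Metric.closedBall (l : ℤ_[2]) ((2 : ℝ) ^ (-i : ℤ)) := by
    ext z
    have h1 := PadicInt.norm_le_pow_iff_mem_span_pow (p := 2) (z - l) i
    rw [Ideal.mem_span_singleton] at h1
    rw [Metric.mem_closedBall, dist_eq_norm]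
    push_cast at h1
    rw [h1]
    constructor
    · rintro ⟨y, rfl⟩; exact ⟨y, by ring⟩
    · rintro ⟨y, hy⟩; exact ⟨y, by rw [← hy]; ring⟩
  rw [h]
  exact IsUltrametricDist.isClopen_closedBall _ (by positivity)

/-- The characteristic function of `l + 2 ^ i ℤ₂`. -/
def indicator (l : ℤ) (i : ℕ) : C(ℤ_[2], ℂ) where
  toFun := Set.indicator (coset l i) 1
  continuous_toFun := continuous_one.indicator (by simp [(isClopen_coset l i).frontier_eq])

theorem range_aff (p : AffSemigroup) : Set.range (aff p) = coset p.l p.i := by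
  ext z
  exact ⟨fun ⟨y, hy⟩ => ⟨y, hy.symm⟩, fun ⟨y, hy⟩ => ⟨y, hy.symm⟩⟩

open Classical in
/-- The function `z ↦ f (2 ^ (-i) (z - l))` on `l + 2 ^ i ℤ₂`, extended by `0`: for `z` in the
coset, `2 ^ (-i) (z - l)` is the unique `y` with `z = l + 2 ^ i y`. -/
def affFun (p : AffSemigroup) (f : ℤ_[2] → ℂ) (z : ℤ_[2]) : ℂ :=
  if h : ∃ y : ℤ_[2], z = aff p y then f h.choose else 0

theorem affFun_aff (p : AffSemigroup) (f : ℤ_[2] → ℂ) (y : ℤ_[2]) : affFun p f (aff p y) = f y := by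
  have h : ∃ y' : ℤ_[2], aff p y = aff p y' := ⟨y, rfl⟩
  rw [affFun, dif_pos h, ← aff_injective p h.choose_spec]

theorem affFun_of_notMem (p : AffSemigroup) (f : ℤ_[2] → ℂ) {z : ℤ_[2]}
    (hz : z ∉ coset p.l p.i) : affFun p f z = 0 :=
  dif_neg hz

theorem continuous_affFun (p : AffSemigroup) (f : C(ℤ_[2], ℂ)) : Continuous (affFun p f) := by
  have hc : Continuous (aff p) := by unfold aff; fun_prop
  have he : Topology.IsOpenEmbedding (aff p) := by
    refine ⟨(hc.isClosedEmbedding (aff_injective p)).isEmbedding, ?_⟩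
    rw [range_aff]
    exact (isClopen_coset _ _).isOpen
  rw [continuous_iff_continuousAt]
  intro z
  by_cases hz : z ∈ coset p.l p.i
  · rw [← range_aff] at hz
    obtain ⟨y, rfl⟩ := hz
    rw [← he.continuousAt_iff]
    have : affFun p f ∘ aff p = f := funext (affFun_aff p f)
    rw [this]
    exact f.continuous.continuousAt
  · have h0 : (fun _ => (0 : ℂ)) =ᶠ[nhds z] affFun p f := by
      filter_upwards [(isClopen_coset p.l p.i).compl.isOpen.mem_nhds hz] with x hx
      exact (affFun_of_notMem p f hx).symm
    exact continuousAt_const.congr h0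

theorem affFun_ext (p : AffSemigroup) {g h : ℤ_[2] → ℂ} (h1 : ∀ y, g (aff p y) = h (aff p y))
    (h2 : ∀ z ∉ coset p.l p.i, g z = h z) (z : ℤ_[2]) : g z = h z := by
  by_cases hz : z ∈ coset p.l p.i
  · rw [← range_aff] at hz
    obtain ⟨y, rfl⟩ := hz
    exact h1 y
  · exact h2 z hz

/-- The endomorphism `α^aff_(l, 2^i)` of `C(ℤ₂)`. -/
def affEnd (p : AffSemigroup) : C(ℤ_[2], ℂ) →⋆ₙₐ[ℂ] C(ℤ_[2], ℂ) where
  toFun f := ⟨affFun p f, continuous_affFun p f⟩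
  map_smul' c f := by
    ext z
    refine affFun_ext p (g := affFun p _) (h := fun z => c • affFun p f z) ?_ ?_ z
    · intro y; simp only [affFun_aff]; rfl
    · intro z hz; simp only [affFun_of_notMem p _ hz, smul_zero]
  map_zero' := by
    ext z
    refine affFun_ext p (g := affFun p _) (h := fun _ => 0) ?_ ?_ z
    · intro y; simp only [affFun_aff]; rfl
    · intro z hz; simp only [affFun_of_notMem p _ hz]
  map_add' f g := by
    ext z
    refine affFun_ext p (g := affFun p _) (h := fun z => affFun p f z + affFun p g z) ?_ ?_ z
    · intro y; simp only [affFun_aff]; rfl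
    · intro z hz; simp only [affFun_of_notMem p _ hz, add_zero]
  map_mul' f g := by
    ext z
    refine affFun_ext p (g := affFun p _) (h := fun z => affFun p f z * affFun p g z) ?_ ?_ z
    · intro y; simp only [affFun_aff]; rfl
    · intro z hz; simp only [affFun_of_notMem p _ hz, mul_zero]
  map_star' f := by
    ext z
    refine affFun_ext p (g := affFun p _) (h := fun z => star (affFun p f z)) ?_ ?_ z
    · intro y; simp only [affFun_aff]; rfl
    · intro z hz; simp only [affFun_of_notMem p _ hz, star_zero]

theorem affEnd_apply (p : AffSemigroup) (f : C(ℤ_[2], ℂ)) (z : ℤ_[2]) :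
    affEnd p f z = affFun p f z := rfl

/-- The action `α^aff` of `ℤ ⋊ [2⟩` on `C(ℤ₂)` by affine transformations. -/
def affAction : AffSemigroup →* (C(ℤ_[2], ℂ) →⋆ₙₐ[ℂ] C(ℤ_[2], ℂ)) where
  toFun := affEnd
  map_one' := by
    ext f z
    have h : aff 1 z = z := by simp [aff]
    have h' := affFun_aff 1 f z
    rw [h] at h'
    exact h'
  map_mul' p q := by
    ext f z
    change affFun (p * q) f z = affFun p (affEnd q f) z
    refine affFun_ext p (fun y => ?_) (fun z hz => ?_) z
    · rw [affFun_aff, affEnd_apply, ← affFun_aff p (affFun q f) y]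
      rw [affFun_aff]
      refine affFun_ext q (g := fun y => affFun (p * q) f (aff p y)) (fun x => ?_)
        (fun x hx => ?_) y
      · simp only [← aff_mul, affFun_aff]
      · rw [affFun_of_notMem q _ hx]
        refine affFun_of_notMem _ _ ?_
        rw [← range_aff] at hx ⊢
        rintro ⟨t, ht⟩
        rw [aff_mul] at ht
        exact hx ⟨t, aff_injective p ht⟩
    · rw [affFun_of_notMem p _ hz]
      refine affFun_of_notMem _ _ ?_
      rw [← range_aff] at hz ⊢
      rintro ⟨t, rfl⟩
      exact hz ⟨aff q t, (aff_mul p q t).symm⟩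

end TwoAdic

end

/-!
The argument has two parts.

**The diagonal.** The projection `u ^ l e_{2^i} u ^ (-l)` depends only on the residue of `l` modulo
`2 ^ i`, is the sum of the projections of the two residues modulo `2 ^ (i + 1)` above it
(`Q2.proj_split`), and is orthogonal to those of the other residues modulo `2 ^ i`. So these
projections multiply as the cosets `l + 2 ^ i ℤ₂` intersect, and `𝒟` is commutative. A character of
`𝒟` takes the value `1` on exactly one residue for each `i`; the corresponding cosets are nested and
shrink to a point of `ℤ₂`. This gives a continuous injection of the spectrum into the compact space
`ℤ₂`. Its image meets every coset because the projections are nonzero: each is the range projection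
of an isometry, and `Q₂` is not zero, as it is represented on `ℓ²(ℤ)` by `ε_n ↦ ε_(n+1)` and
`ε_n ↦ ε_(2n)`. Hence it is a homeomorphism, and equivariance of the Gelfand transform is checked on
the projections.

**The crossed products.** Both `Q₂` and the crossed product are generated by a copy of the
isometries `u ^ l s₂ ^ i`: for the crossed product this holds because `𝒟` is generated by the
projections `α_p 1`, which are mapped to `w_p w_p*`. Every representation of either algebra yields
one of the other with the same values on these generators. The two algebras are built from Hilbert
spaces in unrelated universes, so the representation has to be moved first: a vector on which a given
element does not vanish lies in a separable reducing subspace, which has a copy in any universe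
(`exists_rep_ne_zero`). Then the C⋆-algebra generated by the pairs of corresponding generators is
the graph of an isomorphism (`exists_starAlgEquiv_of_generators`). The proof uses `𝒟` only up to
equivariant isomorphism, so it applies to `C(ℤ₂)` too (`Q2.exists_starAlgEquiv_crossedProduct`).
-/

noncomputable section

/-! ### Homomorphisms and generators -/

theorem StarAlgHom.continuous_of_cstarAlgebra {A : Type u} {B : Type v} [CStarAlgebra A]
    [CStarAlgebra B] (f : A →⋆ₐ[ℂ] B) : Continuous f :=
  AddMonoidHomClass.continuous_of_bound f 1 fun x => by
    rw [one_mul]; exact NonUnitalStarAlgHom.norm_apply_le f x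

theorem StarAlgHom.eqOn_topologicalClosure_adjoin {A : Type u} {B : Type v} [CStarAlgebra A]
    [CStarAlgebra B] {X : Set A} {f g : A →⋆ₐ[ℂ] B} (h : X.EqOn f g) {x : A}
    (hx : x ∈ (StarAlgebra.adjoin ℂ X).topologicalClosure) : f x = g x :=
  StarSubalgebra.topologicalClosure_minimal (t := StarAlgHom.equalizer f g)
    (StarAlgHom.adjoin_le_equalizer f g h)
    (isClosed_eq f.continuous_of_cstarAlgebra g.continuous_of_cstarAlgebra) hx

/-- Agreement at `1` has to be assumed separately, since the homomorphisms need not be unital. -/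
theorem NonUnitalStarAlgHom.eqOn_topologicalClosure_adjoin {A : Type u} {B : Type v}
    [CStarAlgebra A] [CStarAlgebra B] {X : Set A} {f g : A →⋆ₙₐ[ℂ] B} (h : X.EqOn f g)
    (h1 : f 1 = g 1) {x : A} (hx : x ∈ (StarAlgebra.adjoin ℂ X).topologicalClosure) :
    f x = g x := by
  have hc (f : A →⋆ₙₐ[ℂ] B) : Continuous f :=
    AddMonoidHomClass.continuous_of_bound f 1 fun x => by
      rw [one_mul]; exact NonUnitalStarAlgHom.norm_apply_le f x
  refine closure_minimal (s := (StarAlgebra.adjoin ℂ X : Set A)) (t := {y | f y = g y})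
    (fun y hy => ?_) (isClosed_eq (hc f) (hc g)) hx
  induction hy using StarAlgebra.adjoin_induction with
  | mem y hy => exact h hy
  | algebraMap r =>
    change f _ = g _
    rw [Algebra.algebraMap_eq_smul_one, map_smul, map_smul, h1]
  | add a b _ _ ha hb =>
    exact (map_add f a b).trans ((congrArg₂ _ ha hb).trans (map_add g a b).symm)
  | mul a b _ _ ha hb =>
    exact (map_mul f a b).trans ((congrArg₂ _ ha hb).trans (map_mul g a b).symm)
  | star a _ ha => exact (map_star f a).trans ((congrArg _ ha).trans (map_star g a).symm)

/-- An injective homomorphism of C⋆-algebras is surjective if its range contains generators. -/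
theorem surjective_of_injective_of_generators {A : Type u} {B : Type v} [CStarAlgebra A]
    [CStarAlgebra B] {X : Set B} (hX : (StarAlgebra.adjoin ℂ X).topologicalClosure = ⊤)
    (f : A →⋆ₐ[ℂ] B) (hf : Function.Injective f) (h : X ⊆ Set.range f) :
    Function.Surjective f := by
  have hle : (StarAlgebra.adjoin ℂ X).topologicalClosure ≤ f.range :=
    StarSubalgebra.topologicalClosure_minimal (StarAlgebra.adjoin_le h)
      (NonUnitalStarAlgHom.isometry f hf).isClosedEmbedding.isClosed_range
  intro b
  exact hle (by rw [hX]; trivial)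

/-! ### Change of universe for representations -/

theorem Orthonormal.countable_of_separableSpace {E : Type u} [NormedAddCommGroup E]
    [InnerProductSpace ℂ E] [TopologicalSpace.SeparableSpace E] {ι : Type v} {b : ι → E}
    (hb : Orthonormal ℂ b) : Countable ι := by
  rw [← Set.countable_univ_iff]
  refine Set.PairwiseDisjoint.countable_of_isOpen (s := fun i => Metric.ball (b i) (1 / 2)) ?_
    (fun i _ => Metric.isOpen_ball) (fun i _ => Metric.nonempty_ball.2 (by norm_num))
  intro i _ j _ hij
  refine Metric.ball_disjoint_ball ?_
  have h : ‖b i - b j‖ * ‖b i - b j‖ = ‖b i‖ * ‖b i‖ + ‖b j‖ * ‖b j‖ :=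
    by
    rw [norm_sub_mul_self (𝕜 := ℂ), hb.2 hij]; simp
  rw [hb.1, hb.1] at h
  rw [dist_eq_norm]
  nlinarith [norm_nonneg (b i - b j)]

/-- A separable Hilbert space has a copy in every universe. -/
theorem exists_linearIsometryEquiv_lp (E : Type u) [NormedAddCommGroup E] [InnerProductSpace ℂ E]
    [CompleteSpace E] [TopologicalSpace.SeparableSpace E] :
    ∃ ι : Type v, Nonempty (E ≃ₗᵢ[ℂ] lp (fun _ : ι => ℂ) 2) := by
  obtain ⟨t, b, -⟩ := exists_hilbertBasis ℂ E
  have : Countable t := b.orthonormal.countable_of_separableSpace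
  have : Small.{v, u} t := Countable.toSmall t
  let f : Shrink.{v, u} t ≃ t := (equivShrink t).symm
  have hb : ⊤ ≤ (Submodule.span ℂ (Set.range (b ∘ f))).topologicalClosure := by
    rw [f.surjective.range_comp, b.dense_span]
  exact ⟨Shrink.{v, u} t, ⟨(HilbertBasis.mk (b.orthonormal.comp f f.injective) hb).repr⟩⟩

open ContinuousLinearMap in
/-- A countable set of operators, together with a vector, can be compressed to a reducing subspace
that contains the vector and is small enough to have a copy in any prescribed universe: the cyclic
subspace of the vector, which is separable. -/
theorem exists_reducing_isometry {H : Type w₁} [NormedAddCommGroup H] [InnerProductSpace ℂ H]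
    [CompleteSpace H] {T : Set (H →L[ℂ] H)} (hT : T.Countable) (ξ : H) :
    ∃ (K : Type w₂) (_ : NormedAddCommGroup K) (_ : InnerProductSpace ℂ K) (_ : CompleteSpace K)
      (V : K →L[ℂ] H), adjoint V ∘L V = 1 ∧ ξ ∈ Set.range V ∧
        ∀ t ∈ T, Commute (V ∘L adjoint V) t := by
  have hT' : (T ∪ star T).Countable := hT.union (by rw [← Set.image_star]; exact hT.image _)
  have : Countable (T ∪ star T : Set (H →L[ℂ] H)) := hT'
  set M := Submonoid.closure (T ∪ star T) with hM
  have hMc : (M : Set (H →L[ℂ] H)).Countable := by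
    rw [hM, Submonoid.closure_eq_mrange]
    exact Set.countable_range _
  set K₀ : Submodule ℂ H :=
    (Submodule.span ℂ ((fun t : H →L[ℂ] H => t ξ) '' M)).topologicalClosure
  have hsep : TopologicalSpace.IsSeparable (K₀ : Set H) :=
    ((hMc.image _).isSeparable.span (R := ℂ)).closure
  have : TopologicalSpace.SeparableSpace K₀ := hsep.separableSpace
  have : CompleteSpace K₀ := (Submodule.isClosed_topologicalClosure _).completeSpace_coe
  have hξ : ξ ∈ K₀ := Submodule.le_topologicalClosure _
    (Submodule.subset_span ⟨1, M.one_mem, rfl⟩)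
  have hinv : ∀ t ∈ T ∪ star T, ∀ x ∈ K₀, t x ∈ K₀ := by
    intro t ht x hx
    refine map_mem_closure t.continuous hx fun y hy => ?_
    change y ∈ Submodule.span ℂ _ at hy
    change t y ∈ Submodule.span ℂ _
    induction hy using Submodule.span_induction with
    | mem y hy =>
      obtain ⟨m, hm, rfl⟩ := hy
      exact Submodule.subset_span ⟨t * m, M.mul_mem (Submonoid.subset_closure ht) hm, rfl⟩
    | zero => simp
    | add y z _ _ hy hz => rw [map_add]; exact add_mem hy hz
    | smul c y _ hy => rw [map_smul]; exact Submodule.smul_mem _ c hy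
  obtain ⟨ι, ⟨e⟩⟩ := exists_linearIsometryEquiv_lp.{w₁, w₂} K₀
  let V' : lp (fun _ : ι => ℂ) 2 →ₗᵢ[ℂ] H := K₀.subtypeₗᵢ.comp e.symm.toLinearIsometry
  let V := V'.toContinuousLinearMap
  have hV : adjoint V ∘L V = 1 := (norm_map_iff_adjoint_comp_self V).1 V'.norm_map
  have hrange : ∀ x, x ∈ Set.range V ↔ x ∈ K₀ := fun x =>
    ⟨by rintro ⟨y, rfl⟩; exact (e.symm y).2,
      fun hx => ⟨e ⟨x, hx⟩, congrArg Subtype.val (e.symm_apply_apply ⟨x, hx⟩)⟩⟩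
  refine ⟨lp (fun _ : ι => ℂ) 2, inferInstance, inferInstance, inferInstance, V, hV,
    (hrange ξ).2 hξ, ?_⟩
  set P : H →L[ℂ] H := V ∘L adjoint V with hP
  have hPstar : star P = P := by
    rw [star_eq_adjoint, hP, adjoint_comp, adjoint_adjoint]
  -- the range of `P` is invariant under `T` and its adjoints
  have key : ∀ t ∈ T ∪ star T, P * t * P = t * P := by
    intro t ht
    ext x
    obtain ⟨y, hy⟩ := (hrange (t (P x))).2 (hinv t ht _ ((hrange _).1 ⟨adjoint V x, rfl⟩))
    change V (adjoint V (t (P x))) = t (P x)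
    rw [← hy]
    exact congrArg V (DFunLike.congr_fun hV y)
  intro t ht
  -- adjoints of `P t* P = t* P` give `P t P = P t`
  have h1 := key t (Or.inl ht)
  have h2 := congrArg star (key (star t) (Or.inr (by simpa using ht)))
  simp only [star_mul, star_star, hPstar] at h2
  exact (h2.symm.trans (by rw [← mul_assoc])).trans h1

open ContinuousLinearMap in
/-- The compression `x ↦ V* π(x) V` of a representation to a reducing subspace, parametrised by the
isometry `V`. -/
def compressHom {A : Type u} [CStarAlgebra A] {H : Type w₁} [NormedAddCommGroup H]
    [InnerProductSpace ℂ H] [CompleteSpace H] {K : Type w₂} [NormedAddCommGroup K]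
    [InnerProductSpace ℂ K] [CompleteSpace K] (π : A →⋆ₐ[ℂ] (H →L[ℂ] H)) (V : K →L[ℂ] H)
    (hV : adjoint V ∘L V = 1) (hπ : ∀ a, Commute (V ∘L adjoint V) (π a)) :
    A →⋆ₐ[ℂ] (K →L[ℂ] K) where
  toFun a := adjoint V ∘L π a ∘L V
  map_one' := by rw [map_one]; exact hV
  map_zero' := by rw [map_zero]; simp
  map_add' a b := by rw [map_add]; ext x; simp
  map_mul' a b := by
    ext x
    have h1 : V (adjoint V (π b (V x))) = π b (V (adjoint V (V x))) :=
      DFunLike.congr_fun (hπ b).eq (V x)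
    have h2 : adjoint V (V x) = x := DFunLike.congr_fun hV x
    change adjoint V (π (a * b) (V x)) = adjoint V (π a (V (adjoint V (π b (V x)))))
    rw [h1, h2, map_mul]
    rfl
  commutes' c := by
    ext x
    have h2 : adjoint V (V x) = x := DFunLike.congr_fun hV x
    simp [Algebra.algebraMap_eq_smul_one, h2]
  map_star' a := by
    simp only [map_star, star_eq_adjoint, adjoint_comp, adjoint_adjoint, comp_assoc]

open ContinuousLinearMap in
theorem apply_compressHom {A : Type u} [CStarAlgebra A] {H : Type w₁} [NormedAddCommGroup H]
    [InnerProductSpace ℂ H] [CompleteSpace H] {K : Type w₂} [NormedAddCommGroup K]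
    [InnerProductSpace ℂ K] [CompleteSpace K] (π : A →⋆ₐ[ℂ] (H →L[ℂ] H)) (V : K →L[ℂ] H)
    (hV : adjoint V ∘L V = 1) (hπ : ∀ a, Commute (V ∘L adjoint V) (π a)) (a : A) (η : K) :
    V (compressHom π V hV hπ a η) = π a (V η) := by
  have h1 : V (adjoint V (π a (V η))) = π a (V (adjoint V (V η))) :=
    DFunLike.congr_fun (hπ a).eq (V η)
  have h2 : adjoint V (V η) = η := DFunLike.congr_fun hV η
  change V (adjoint V (π a (V η))) = _
  rw [h1, h2]

/-- A representation of a countably generated C⋆-algebra that does not vanish at `a` can be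
compressed to a representation with the same property on a Hilbert space in any universe. -/
theorem exists_rep_ne_zero {A : Type u} [CStarAlgebra A] {X : Set A} (hX : X.Countable)
    (hA : (StarAlgebra.adjoin ℂ X).topologicalClosure = ⊤) {H : Type w₁} [NormedAddCommGroup H]
    [InnerProductSpace ℂ H] [CompleteSpace H] (π : A →⋆ₐ[ℂ] (H →L[ℂ] H)) {a : A} (ha : π a ≠ 0) :
    ∃ (K : Type w₂) (_ : NormedAddCommGroup K) (_ : InnerProductSpace ℂ K) (_ : CompleteSpace K)
      (_ : Nontrivial K) (κ : A →⋆ₐ[ℂ] (K →L[ℂ] K)), κ a ≠ 0 := by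
  obtain ⟨ξ, hξ⟩ : ∃ ξ, π a ξ ≠ 0 := by
    by_contra! h
    exact ha (ContinuousLinearMap.ext h)
  obtain ⟨K, i1, i2, i3, V, hV, ⟨η, rfl⟩, hcomm⟩ :=
    exists_reducing_isometry.{w₁, w₂} (hX.image π) ξ
  have hπ : ∀ b, Commute (V ∘L ContinuousLinearMap.adjoint V) (π b) := by
    set P := V ∘L ContinuousLinearMap.adjoint V with hP
    have hPstar : star P = P := by
      rw [ContinuousLinearMap.star_eq_adjoint, hP, ContinuousLinearMap.adjoint_comp,
        ContinuousLinearMap.adjoint_adjoint]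
    have hle : (StarAlgebra.adjoin ℂ X).topologicalClosure ≤
        (StarSubalgebra.centralizer ℂ {P}).comap π := by
      refine StarSubalgebra.topologicalClosure_minimal (StarAlgebra.adjoin_le fun x hx => ?_) ?_
      · rw [StarSubalgebra.coe_comap, Set.mem_preimage, SetLike.mem_coe,
          StarSubalgebra.mem_centralizer_iff]
        rintro _ rfl
        rw [hPstar]
        exact ⟨hcomm _ ⟨x, hx, rfl⟩, hcomm _ ⟨x, hx, rfl⟩⟩
      · exact (Set.isClosed_centralizer _).preimage π.continuous_of_cstarAlgebra
    intro b
    have hb : b ∈ (StarSubalgebra.centralizer ℂ {P}).comap π := hle (by rw [hA]; trivial)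
    exact ((StarSubalgebra.mem_centralizer_iff ℂ).1 hb P rfl).1
  refine ⟨K, i1, i2, i3, ⟨⟨η, 0, ?_⟩⟩, compressHom π V hV hπ, fun h0 => hξ ?_⟩
  · rintro rfl
    exact hξ (by simp)
  · rw [← apply_compressHom π V hV hπ, h0]
    simp

/-! ### Isomorphism of C⋆-algebras with matching generators -/

/-- Two C⋆-algebras with generators `a i` and `b i` are isomorphic by `a i ↦ b i` if every nonzero
element of either of them is detected by a homomorphism that has a counterpart on the other
algebra with the same values on the generators. The graph of the isomorphism is the C⋆-algebra
generated by the pairs `(a i, b i)`. -/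
theorem exists_starAlgEquiv_of_generators {A : Type u} {B : Type v} [CStarAlgebra A]
    [CStarAlgebra B] {I : Type*} {a : I → A} {b : I → B}
    (ha : (StarAlgebra.adjoin ℂ (Set.range a)).topologicalClosure = ⊤)
    (hb : (StarAlgebra.adjoin ℂ (Set.range b)).topologicalClosure = ⊤)
    (hA : ∀ x : A, x ≠ 0 → ∃ (C : Type w₁) (_ : CStarAlgebra C) (f : A →⋆ₐ[ℂ] C)
      (g : B →⋆ₐ[ℂ] C), (∀ i, f (a i) = g (b i)) ∧ f x ≠ 0)
    (hB : ∀ y : B, y ≠ 0 → ∃ (C : Type w₂) (_ : CStarAlgebra C) (f : A →⋆ₐ[ℂ] C)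
      (g : B →⋆ₐ[ℂ] C), (∀ i, f (a i) = g (b i)) ∧ g y ≠ 0) :
    ∃ Φ : A ≃⋆ₐ[ℂ] B, ∀ i, Φ (a i) = b i := by
  set G : StarSubalgebra ℂ (A × B) :=
    (StarAlgebra.adjoin ℂ (Set.range fun i => (a i, b i))).topologicalClosure
  have hmem : ∀ i, (a i, b i) ∈ G := fun i =>
    StarSubalgebra.le_topologicalClosure _ (StarAlgebra.subset_adjoin ℂ _ ⟨i, rfl⟩)
  let p : G →⋆ₐ[ℂ] A := (StarAlgHom.fst ℂ A B).comp G.subtype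
  let q : G →⋆ₐ[ℂ] B := (StarAlgHom.snd ℂ A B).comp G.subtype
  have hp : Function.Bijective p := by
    have hinj : Function.Injective p := by
      rw [injective_iff_map_eq_zero]
      intro z (hz : z.1.1 = 0)
      by_contra hne
      obtain ⟨C, _, f, g, hfg, hy⟩ := hB z.1.2 fun h => hne (Subtype.ext (Prod.ext hz h))
      have h : f z.1.1 = g z.1.2 := StarAlgHom.eqOn_topologicalClosure_adjoin
        (f := f.comp (StarAlgHom.fst ℂ A B)) (g := g.comp (StarAlgHom.snd ℂ A B))
        (by rintro _ ⟨i, rfl⟩; exact hfg i) z.2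
      rw [hz, map_zero] at h
      exact hy h.symm
    refine ⟨hinj, surjective_of_injective_of_generators ha p hinj ?_⟩
    rintro _ ⟨i, rfl⟩
    exact ⟨⟨_, hmem i⟩, rfl⟩
  have hq : Function.Bijective q := by
    have hinj : Function.Injective q := by
      rw [injective_iff_map_eq_zero]
      intro z (hz : z.1.2 = 0)
      by_contra hne
      obtain ⟨C, _, f, g, hfg, hy⟩ := hA z.1.1 fun h => hne (Subtype.ext (Prod.ext h hz))
      have h : f z.1.1 = g z.1.2 := StarAlgHom.eqOn_topologicalClosure_adjoin
        (f := f.comp (StarAlgHom.fst ℂ A B)) (g := g.comp (StarAlgHom.snd ℂ A B))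
        (by rintro _ ⟨i, rfl⟩; exact hfg i) z.2
      rw [hz, map_zero] at h
      exact hy h
    refine ⟨hinj, surjective_of_injective_of_generators hb q hinj ?_⟩
    rintro _ ⟨i, rfl⟩
    exact ⟨⟨_, hmem i⟩, rfl⟩
  refine ⟨(StarAlgEquiv.ofBijective p hp).symm.trans (StarAlgEquiv.ofBijective q hq), fun i => ?_⟩
  have h : (StarAlgEquiv.ofBijective p hp).symm (a i) = ⟨_, hmem i⟩ := by
    rw [StarAlgEquiv.symm_apply_eq]
    rfl
  rw [StarAlgEquiv.trans_apply, h]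
  rfl

/-! ### The isomorphism with the crossed product -/

/-- If a C⋆-algebra is embedded as the C⋆-subalgebra generated by `X`, then it is generated by the
elements that the embedding maps to `X`. -/
theorem topologicalClosure_adjoin_preimage {A : Type u} {B : Type v} [CStarAlgebra A]
    [CStarAlgebra B] {X : Set B} (f : A →⋆ₐ[ℂ] B) (hf : Function.Injective f)
    (hX : X ⊆ Set.range f) (h : ∀ x, f x ∈ (StarAlgebra.adjoin ℂ X).topologicalClosure) :
    (StarAlgebra.adjoin ℂ (f ⁻¹' X)).topologicalClosure = ⊤ := by
  have hle : (StarAlgebra.adjoin ℂ X).topologicalClosure ≤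
      (StarAlgebra.adjoin ℂ (f ⁻¹' X)).topologicalClosure.map f := by
    refine StarSubalgebra.topologicalClosure_minimal (StarAlgebra.adjoin_le fun y hy => ?_)
      ((NonUnitalStarAlgHom.isometry f hf).isClosedEmbedding.isClosedMap _
        (StarSubalgebra.isClosed_topologicalClosure _))
    obtain ⟨x, rfl⟩ := hX hy
    exact ⟨x, StarSubalgebra.le_topologicalClosure _ (StarAlgebra.subset_adjoin ℂ _ hy), rfl⟩
  refine eq_top_iff.2 fun x _ => ?_
  obtain ⟨y, hy, hyx⟩ := hle (h x)
  rwa [← hf hyx]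

namespace Q2

theorem mono_one_zero : mono.{w} ⟨1, 0⟩ = u := by simp [mono_apply]

theorem mono_zero_one : mono.{w} ⟨0, 1⟩ = s := by simp [mono_apply]

/-- The inclusion of `Q₂` into the direct sum of all representations of its relations. -/
def toAmbient : Q2.{w} →⋆ₐ[ℂ] Ambient.{w} where
  toFun x := x.1
  map_one' := rfl
  map_mul' _ _ := rfl
  map_zero' := rfl
  map_add' _ _ := rfl
  commutes' _ := rfl
  map_star' _ := rfl

theorem topologicalClosure_adjoin_range_mono :
    (StarAlgebra.adjoin ℂ (Set.range mono.{w})).topologicalClosure = ⊤ := by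
  refine eq_top_iff.2 (le_trans (topologicalClosure_adjoin_preimage (X := {univU.{w}, univS.{w}})
    toAmbient Subtype.val_injective ?_ fun x => x.2).ge
    (StarSubalgebra.topologicalClosure_mono (StarAlgebra.adjoin_le fun x hx =>
      StarAlgebra.subset_adjoin ℂ _ ?_)))
  · rintro _ (rfl | rfl)
    exacts [⟨uElt, rfl⟩, ⟨s, rfl⟩]
  · rcases hx with hx | hx
    · exact ⟨⟨1, 0⟩, mono_one_zero.trans (Subtype.ext hx.symm)⟩
    · exact ⟨⟨0, 1⟩, mono_zero_one.trans (Subtype.ext hx.symm)⟩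

theorem topologicalClosure_adjoin_range_diagProj :
    (StarAlgebra.adjoin ℂ {x : diag.{w} | ∃ l i, x = diagProj l i}).topologicalClosure = ⊤ := by
  refine eq_top_iff.2 (le_trans (topologicalClosure_adjoin_preimage
    (X := {x : Q2.{w} | ∃ l i, x = proj l i}) diag.{w}.subtype Subtype.val_injective ?_
    fun x => x.2).ge (StarSubalgebra.topologicalClosure_mono (StarAlgebra.adjoin_le fun x hx =>
      StarAlgebra.subset_adjoin ℂ _ ?_)))
  · rintro _ ⟨l, i, rfl⟩
    exact ⟨diagProj l i, rfl⟩
  · obtain ⟨l, i, h⟩ := hx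
    exact ⟨l, i, Subtype.ext h⟩

theorem diagAction_one (l : ℤ) (i : ℕ) : diagAction.{w} ⟨l, i⟩ 1 = diagProj l i := by
  refine Subtype.ext ?_
  change mono ⟨l, i⟩ * (1 : Q2.{w}) * star (mono ⟨l, i⟩) = proj l i
  rw [mul_one, proj_eq]

theorem diagAction_diagProj (p : AffSemigroup) (l : ℤ) (i : ℕ) :
    diagAction.{w} p (diagProj l i) = diagProj (p * ⟨l, i⟩).l (p * ⟨l, i⟩).i := by
  rw [← diagAction_one, ← diagAction_one, map_mul]
  rfl

end Q2

instance : Countable AffSemigroup :=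
  Function.Injective.countable (f := fun p : AffSemigroup => (p.l, p.i))
    fun _ _ h => AffSemigroup.ext (congrArg Prod.fst h) (congrArg Prod.snd h)

/-- A homomorphism on `ℤ ⋊ [2⟩` is determined by its values at `(1, 1)` and `(0, 2)`. -/
theorem AffSemigroup.hom_ext {M : Type u} [Monoid M] {f g : AffSemigroup →* M}
    (h1 : f ⟨1, 0⟩ = g ⟨1, 0⟩) (h2 : f ⟨0, 1⟩ = g ⟨0, 1⟩) : f = g := by
  let t : Multiplicative ℤ →* AffSemigroup :=
    { toFun := fun n => ⟨n.toAdd, 0⟩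
      map_one' := rfl
      map_mul' := fun m n => by ext <;> simp }
  have ht : f.comp t = g.comp t := MonoidHom.ext_mint h1
  ext p
  have hp : p = t (Multiplicative.ofAdd p.l) * ⟨0, 1⟩ ^ p.i := by
    have hpow : ∀ n : ℕ, (⟨0, 1⟩ : AffSemigroup) ^ n = ⟨0, n⟩ := by
      intro n
      induction n with
      | zero => rfl
      | succ n ih => rw [pow_succ, ih]; ext <;> simp
    rw [hpow]
    ext <;> simp [t]
  rw [hp, map_mul, map_mul, map_pow, map_pow, h2]
  congr 1
  exact DFunLike.congr_fun ht _

namespace SemigroupCrossedProduct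

variable {D : Type u} [CStarAlgebra D] {α : AffSemigroup →* (D →⋆ₙₐ[ℂ] D)}

variable (α) in
/-- The inclusion of the crossed product into the direct sum of all covariant pairs. -/
def toAmbient : SemigroupCrossedProduct.{u, 0, w₁} α →⋆ₐ[ℂ] Ambient.{u, 0, w₁} α where
  toFun x := x.1
  map_one' := rfl
  map_mul' _ _ := rfl
  map_zero' := rfl
  map_add' _ _ := rfl
  commutes' _ := rfl
  map_star' _ := rfl

/-- The isometries `w_p` generate the crossed product: the algebra acted on is generated by the
projections `α_p 1`, and `ι (α_p 1) = w_p w_p*`. -/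
theorem topologicalClosure_adjoin_range_isom (Γ : Q2.diag.{w} ≃⋆ₐ[ℂ] D)
    (hΓ : ∀ p a, Γ (Q2.diagAction p a) = α p (Γ a)) :
    (StarAlgebra.adjoin ℂ (Set.range (isom.{u, 0, w₁} α))).topologicalClosure = ⊤ := by
  have hι : ∀ d : D, ι α d ∈
      (StarAlgebra.adjoin ℂ (Set.range (isom.{u, 0, w₁} α))).topologicalClosure := by
    intro d
    obtain ⟨d, rfl⟩ := Γ.surjective d
    set f : Q2.diag.{w} →⋆ₐ[ℂ] SemigroupCrossedProduct.{u, 0, w₁} α := (ι α).comp Γ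
    have hle : (StarAlgebra.adjoin ℂ
        {x : Q2.diag.{w} | ∃ l i, x = Q2.diagProj l i}).topologicalClosure ≤
        ((StarAlgebra.adjoin ℂ (Set.range (isom.{u, 0, w₁} α))).topologicalClosure).comap f := by
      refine StarSubalgebra.topologicalClosure_minimal (StarAlgebra.adjoin_le ?_)
        ((StarSubalgebra.isClosed_topologicalClosure _).preimage f.continuous_of_cstarAlgebra)
      rintro _ ⟨l, i, rfl⟩
      refine StarSubalgebra.le_topologicalClosure _ ?_
      change ι α (Γ (Q2.diagProj l i)) ∈ _
      rw [← Q2.diagAction_one, hΓ, ι_covariant, map_one, map_one, mul_one]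
      have h : isom.{u, 0, w₁} α ⟨l, i⟩ ∈ StarAlgebra.adjoin ℂ (Set.range (isom.{u, 0, w₁} α)) :=
        StarAlgebra.subset_adjoin ℂ _ ⟨_, rfl⟩
      exact mul_mem h (star_mem h)
    exact hle (by rw [Q2.topologicalClosure_adjoin_range_diagProj]; trivial)
  refine eq_top_iff.2 (le_trans (topologicalClosure_adjoin_preimage
    (X := Set.range (univRep.{u, 0, w₁} α) ∪ Set.range (univIsom.{u, 0, w₁} α))
    (toAmbient α) Subtype.val_injective ?_ fun x => x.2).ge
    (StarSubalgebra.topologicalClosure_minimal (StarAlgebra.adjoin_le fun x hx => ?_)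
    (StarSubalgebra.isClosed_topologicalClosure _)))
  · rintro _ (⟨d, rfl⟩ | ⟨p, rfl⟩)
    exacts [⟨ι α d, rfl⟩, ⟨isom α p, rfl⟩]
  rcases hx with ⟨d, hd⟩ | ⟨p, hp⟩
  · have : x = ι α d := Subtype.ext hd.symm
    rw [this]
    exact hι d
  · have : x = isom α p := Subtype.ext hp.symm
    rw [this]
    exact StarSubalgebra.le_topologicalClosure _ (StarAlgebra.subset_adjoin ℂ _ ⟨p, rfl⟩)

theorem isom_mul_star_isom_one_zero :
    isom.{u, 0, w₁} α ⟨1, 0⟩ * star (isom α ⟨1, 0⟩) = 1 := by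
  have h : isom.{u, 0, w₁} α ⟨1, 0⟩ * isom α ⟨-1, 0⟩ = 1 := by
    rw [← map_mul, ← map_one (isom α)]
    congr 1
  have h2 := star_isom_mul_isom.{u, 0, w₁} α ⟨1, 0⟩
  rw [left_inv_eq_right_inv h2 h, h]

/-- The representation of the relations of `Q₂` given by a representation of the crossed product. -/
def toQ2Rep (Γ : Q2.diag.{w} ≃⋆ₐ[ℂ] D) (hΓ : ∀ p a, Γ (Q2.diagAction p a) = α p (Γ a))
    {K : Type w₂} [NormedAddCommGroup K] [InnerProductSpace ℂ K] [CompleteSpace K] [Nontrivial K]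
    (κ : SemigroupCrossedProduct.{u, 0, w₁} α →⋆ₐ[ℂ] (K →L[ℂ] K)) : Q2Rep.{w₂} where
  H := K
  U := ⟨κ (isom α ⟨1, 0⟩), by rw [← map_star, ← map_mul, star_isom_mul_isom, map_one], by
    rw [← map_star, ← map_mul, isom_mul_star_isom_one_zero, map_one]⟩
  S := κ (isom α ⟨0, 1⟩)
  isometry := by rw [← map_star, ← map_mul, star_isom_mul_isom, map_one]
  rel_one := by
    change κ (isom α ⟨0, 1⟩) * κ (isom α ⟨1, 0⟩) = κ (isom α ⟨1, 0⟩) ^ 2 * κ (isom α ⟨0, 1⟩)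
    rw [← map_pow, ← map_mul, ← map_mul, ← map_pow, ← map_mul, ← map_mul]
    rfl
  rel_two := by
    change κ (isom α ⟨0, 1⟩) * star (κ (isom α ⟨0, 1⟩)) +
      κ (isom α ⟨1, 0⟩) * (κ (isom α ⟨0, 1⟩) * star (κ (isom α ⟨0, 1⟩))) *
        star (κ (isom α ⟨1, 0⟩)) = 1
    have h : Q2.proj.{w} 0 1 + Q2.proj 1 1 = 1 := by
      simpa [Q2.proj, Q2.e] using Q2.s_range_sum.{w}
    have h2 : Q2.diagAction.{w} ⟨0, 1⟩ 1 + Q2.diagAction ⟨1, 1⟩ 1 = 1 := by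
      rw [Q2.diagAction_one, Q2.diagAction_one]
      exact Subtype.ext h
    have h3 := congrArg (fun x => κ (ι α (Γ x))) h2
    simp only [map_add, hΓ, ι_covariant, map_one, mul_one] at h3
    -- `(1, 2) = (1, 1) (0, 2)`
    have h4 : isom.{u, 0, w₁} α ⟨1, 1⟩ = isom α ⟨1, 0⟩ * isom α ⟨0, 1⟩ := by
      rw [← map_mul]; rfl
    rw [h4] at h3
    simpa only [map_mul, map_star, star_mul, mul_assoc] using h3

end SemigroupCrossedProduct

open SemigroupCrossedProduct in
/-- `Q₂` is the crossed product by `ℤ ⋊ [2⟩` of any algebra equivariantly isomorphic to its diagonal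
subalgebra. -/
theorem Q2.exists_starAlgEquiv_crossedProduct {D : Type u} [CStarAlgebra D]
    {α : AffSemigroup →* (D →⋆ₙₐ[ℂ] D)} (Γ : Q2.diag.{w} ≃⋆ₐ[ℂ] D)
    (hΓ : ∀ p a, Γ (Q2.diagAction p a) = α p (Γ a)) :
    ∃ Φ : Q2.{w} ≃⋆ₐ[ℂ] SemigroupCrossedProduct.{u, 0, w₁} α, ∀ p, Φ (mono p) = isom α p := by
  refine exists_starAlgEquiv_of_generators.{w + 1, max u (w₁ + 1), w₁, w}
    topologicalClosure_adjoin_range_mono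
    (topologicalClosure_adjoin_range_isom Γ hΓ) (fun x hx => ?_) (fun y hy => ?_)
  · obtain ⟨ρ, hρ⟩ : ∃ ρ, rep ρ x ≠ 0 := by
      by_contra! h
      exact hx (ext_rep fun ρ => by rw [h, map_zero])
    -- compress to a Hilbert space in the universe of the covariant pairs
    obtain ⟨K, _, _, _, _, κ, hκ⟩ := exists_rep_ne_zero.{w + 1, w, w₁}
      (Set.countable_range mono.{w}) topologicalClosure_adjoin_range_mono (rep ρ) hρ
    let σ : CovariantRep.{u, 0, w₁} α :=
      { H := K
        π := (κ.comp diag.{w}.subtype).comp Γ.symm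
        W := (κ : Q2.{w} →* (K →L[ℂ] K)).comp mono
        isometry := fun p => by
          change star (κ (mono p)) * κ (mono p) = 1
          rw [← map_star, ← map_mul, star_mono_mul, map_one]
        covariant := fun p a => by
          obtain ⟨a, rfl⟩ := Γ.surjective a
          change κ (Γ.symm (α p (Γ a)) : diag.{w}) =
            κ (mono p) * κ (Γ.symm (Γ a) : diag.{w}) * star (κ (mono p))
          rw [← hΓ, Γ.symm_apply_apply, Γ.symm_apply_apply, ← map_star, ← map_mul, ← map_mul]
          rfl }
    exact ⟨K →L[ℂ] K, inferInstance, κ, SemigroupCrossedProduct.rep α σ, fun p => rfl, hκ⟩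
  · obtain ⟨ρ, hρ⟩ : ∃ ρ, SemigroupCrossedProduct.rep α ρ y ≠ 0 := by
      by_contra! h
      exact hy (SemigroupCrossedProduct.ext_rep fun ρ => by rw [h, map_zero])
    obtain ⟨K, _, _, _, _, κ, hκ⟩ := exists_rep_ne_zero.{max u (w₁ + 1), w₁, w}
      (Set.countable_range (isom.{u, 0, w₁} α)) (topologicalClosure_adjoin_range_isom Γ hΓ)
      (SemigroupCrossedProduct.rep α ρ) hρ
    let θ : Q2.{w} →⋆ₐ[ℂ] (K →L[ℂ] K) := rep (toQ2Rep Γ hΓ κ)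
    refine ⟨K →L[ℂ] K, inferInstance, θ, κ, fun p => ?_, hκ⟩
    refine DFunLike.congr_fun (AffSemigroup.hom_ext
      (f := (θ : Q2.{w} →* (K →L[ℂ] K)).comp mono)
      (g := (κ : SemigroupCrossedProduct.{u, 0, w₁} α →* (K →L[ℂ] K)).comp (isom α)) ?_ ?_) p
    · exact congrArg θ mono_one_zero
    · exact congrArg θ mono_zero_one

/-! ### A representation of the relations on `ℓ²(ℤ)` -/

section Regular

variable {I : Type u}

theorem summable_norm_sq_lp (x : lp (fun _ : I => ℂ) 2) : Summable fun i => ‖x i‖ ^ 2 := by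
  simpa using (lp.memℓp x).summable (by norm_num)

theorem norm_sq_lp (x : lp (fun _ : I => ℂ) 2) : ‖x‖ ^ 2 = ∑' i, ‖x i‖ ^ 2 := by
  simpa using lp.norm_rpow_eq_tsum (p := 2) (by norm_num) x

/-- Composition with an injective map, as an operator on `ℓ²`. -/
def lpComp (f : I → I) (hf : Function.Injective f) :
    lp (fun _ : I => ℂ) 2 →L[ℂ] lp (fun _ : I => ℂ) 2 :=
  LinearMap.mkContinuous
    { toFun := fun x => ⟨fun i => x (f i), by
        refine memℓp_gen ?_
        simpa [Function.comp_def] using (summable_norm_sq_lp x).comp_injective hf⟩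
      map_add' := fun _ _ => rfl
      map_smul' := fun _ _ => rfl } 1 fun x => by
    rw [one_mul]
    refine le_of_sq_le_sq ?_ (norm_nonneg _)
    rw [norm_sq_lp, norm_sq_lp]
    exact tsum_comp_le_tsum_of_inj (summable_norm_sq_lp x) (fun i => by positivity) hf

theorem lpComp_apply (f : I → I) (hf : Function.Injective f) (x : lp (fun _ : I => ℂ) 2) (i : I) :
    lpComp f hf x i = x (f i) := rfl

theorem lp_apply_eq_inner [DecidableEq I] (y : lp (fun _ : I => ℂ) 2) (j : I) :
    y j = inner ℂ (lp.single 2 j (1 : ℂ)) y := by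
  rw [lp.inner_single_left]; simp

theorem adjoint_lpComp_apply (f : I → I) (hf : Function.Injective f)
    (x : lp (fun _ : I => ℂ) 2) (i : I) : star (lpComp f hf) x (f i) = x i := by
  classical
  rw [lp_apply_eq_inner, ContinuousLinearMap.star_eq_adjoint,
    ContinuousLinearMap.adjoint_inner_right, lp_apply_eq_inner x]
  congr 1
  ext j
  rw [lpComp_apply]
  by_cases h : j = i
  · subst h; simp
  · rw [lp.single_apply_ne _ _ _ h, lp.single_apply_ne _ _ _ (hf.ne h)]

theorem adjoint_lpComp_apply_of_notMem (f : I → I) (hf : Function.Injective f)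
    (x : lp (fun _ : I => ℂ) 2) {k : I} (hk : k ∉ Set.range f) : star (lpComp f hf) x k = 0 := by
  classical
  rw [lp_apply_eq_inner, ContinuousLinearMap.star_eq_adjoint,
    ContinuousLinearMap.adjoint_inner_right]
  have h0 : lpComp f hf (lp.single 2 k (1 : ℂ)) = 0 := by
    ext j
    rw [lpComp_apply, lp.single_apply_ne _ _ _ fun h => hk ⟨j, h⟩]
    rfl
  rw [h0, inner_zero_left]

theorem lpComp_mul_lpComp (f g : I → I) (hf : Function.Injective f) (hg : Function.Injective g) :
    lpComp f hf * lpComp g hg = lpComp (g ∘ f) (hg.comp hf) := rfl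

theorem lpComp_mul_adjoint (f : I → I) (hf : Function.Injective f) :
    lpComp f hf * star (lpComp f hf) = 1 := by
  ext x i
  exact adjoint_lpComp_apply f hf x i

theorem adjoint_mul_lpComp_apply (f : I → I) (hf : Function.Injective f)
    (x : lp (fun _ : I => ℂ) 2) (i : I) : (star (lpComp f hf) * lpComp f hf) x (f i) = x (f i) :=
  adjoint_lpComp_apply f hf _ i

theorem adjoint_mul_lpComp_apply_of_notMem (f : I → I) (hf : Function.Injective f)
    (x : lp (fun _ : I => ℂ) 2) {k : I} (hk : k ∉ Set.range f) :
    (star (lpComp f hf) * lpComp f hf) x k = 0 :=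
  adjoint_lpComp_apply_of_notMem f hf _ hk

theorem adjoint_mul_lpComp_of_surjective (f : I → I) (hf : Function.Injective f)
    (hs : Function.Surjective f) : star (lpComp f hf) * lpComp f hf = 1 := by
  ext x i
  obtain ⟨i, rfl⟩ := hs i
  exact adjoint_mul_lpComp_apply f hf x i

end Regular

namespace Q2

/-- The translation `n ↦ n + 1` of `ℤ`, lifted to an arbitrary universe. -/
def shift (n : ULift.{w} ℤ) : ULift.{w} ℤ := ⟨n.down + 1⟩

/-- The dilation `n ↦ 2 n` of `ℤ`, lifted to an arbitrary universe. -/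
def double (n : ULift.{w} ℤ) : ULift.{w} ℤ := ⟨2 * n.down⟩

theorem shift_injective : Function.Injective shift.{w} := fun m n h => by
  have h1 : m.down + 1 = n.down + 1 := congrArg ULift.down h
  ext
  lia

theorem shift_surjective : Function.Surjective shift.{w} := fun n =>
  ⟨⟨n.down - 1⟩, ULift.ext _ _ (sub_add_cancel _ _)⟩

theorem double_injective : Function.Injective double.{w} := fun m n h => by
  have h1 : 2 * m.down = 2 * n.down := congrArg ULift.down h
  ext
  lia

theorem adjoint_double_mul_add_conj_shift :
    star (lpComp double.{w} double_injective) * lpComp double double_injective +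
      star (lpComp shift shift_injective) *
        (star (lpComp double double_injective) * lpComp double double_injective) *
          lpComp shift shift_injective = 1 := by
  have hE := adjoint_mul_lpComp_apply double.{w} double_injective
  have hE0 := fun x {k} => adjoint_mul_lpComp_apply_of_notMem double.{w} double_injective x (k := k)
  have hT := lpComp_apply shift.{w} shift_injective
  have hT' := adjoint_lpComp_apply shift.{w} shift_injective
  generalize star (lpComp double.{w} double_injective) * lpComp double double_injective = E at *
  generalize star (lpComp shift.{w} shift_injective) = T' at *
  generalize lpComp shift.{w} shift_injective = T at *
  ext x n
  obtain ⟨k, rfl⟩ := shift_surjective n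
  have h1 : (E + T' * E * T) x (shift k) = E x (shift k) + E (T x) k :=
    congrArg (E x (shift k) + ·) (hT' _ k)
  rw [h1, one_apply_eq_self]
  rcases Int.even_or_odd' k.down with ⟨m, hm | hm⟩
  · have hk : k = double ⟨m⟩ := ULift.ext _ _ hm
    have h0 : shift k ∉ Set.range double := by
      rintro ⟨j, hj⟩
      have : 2 * j.down = k.down + 1 := congrArg ULift.down hj
      lia
    rw [hE0 x h0, zero_add, hk, hE, hT]
  · have hk : shift k = double ⟨m + 1⟩ := ULift.ext _ _ (by simp only [shift, double]; lia)
    have h0 : k ∉ Set.range double := by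
      rintro ⟨j, hj⟩
      have : 2 * j.down = k.down := congrArg ULift.down hj
      lia
    rw [hE0 _ h0, add_zero, hk, hE]

/-- The representation on `ℓ²(ℤ)` with `U ε_n = ε_(n+1)` and `S ε_n = ε_(2n)`. Both operators are
adjoints of composition operators. -/
def regularRep : Q2Rep.{w} where
  H := lp (fun _ : ULift.{w} ℤ => ℂ) 2
  nontrivial := ⟨⟨lp.single 2 ⟨0⟩ (1 : ℂ), 0, fun h => by
    have := congrArg (fun x : lp (fun _ : ULift.{w} ℤ => ℂ) 2 => x ⟨0⟩) h
    simp at this⟩⟩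
  U := star ⟨lpComp shift shift_injective,
    adjoint_mul_lpComp_of_surjective _ _ shift_surjective, lpComp_mul_adjoint _ _⟩
  S := star (lpComp double double_injective)
  isometry := by rw [star_star]; exact lpComp_mul_adjoint _ _
  rel_one := by
    rw [SubmonoidClass.coe_pow, Unitary.coe_star, ← star_mul, ← star_pow, ← star_mul, pow_two]
    simp only [lpComp_mul_lpComp]
    congr 2
    ext n
    simp only [shift, double, Function.comp_apply]
    ring
  rel_two := by
    rw [← Unitary.star_eq_inv, star_star, star_star]
    exact adjoint_double_mul_add_conj_shift

instance : Nontrivial Q2.{w} := (rep regularRep.{w}).toRingHom.domain_nontrivial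

end Q2

/-! ### The projections `u ^ l e_{2^i} u ^ (-l)` -/

namespace Q2

theorem star_proj (l : ℤ) (i : ℕ) : star (proj.{w} l i) = proj l i := by
  rw [proj_eq, star_mul, star_star]

theorem mono_conj_proj (p : AffSemigroup) (l : ℤ) (i : ℕ) :
    mono p * proj.{w} l i * star (mono p) = proj (p.l + 2 ^ p.i * l) (p.i + i) :=
  congrArg Subtype.val (diagAction_diagProj p l i)

theorem proj_zero (l : ℤ) : proj.{w} l 0 = 1 := by
  simp [proj, e, ← Submonoid.coe_mul]

theorem proj_congr {l n : ℤ} {i : ℕ} (h : (2 : ℤ) ^ i ∣ l - n) : proj.{w} l i = proj n i := by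
  obtain ⟨k, hk⟩ := h
  have h1 := mono_conj_proj.{w} ⟨n, i⟩ k 0
  rw [proj_zero, mul_one, ← proj_eq] at h1
  rw [h1, ← hk]
  congr 1
  ring

/-- The projection of a residue modulo `2 ^ i` is the sum of those of its two lifts modulo
`2 ^ (i + 1)`: conjugate `s₂ s₂* + u s₂ s₂* u⁻¹ = 1` by `u ^ l s₂ ^ i`. -/
theorem proj_split (l : ℤ) (i : ℕ) :
    proj.{w} l i = proj l (i + 1) + proj (l + 2 ^ i) (i + 1) := by
  have h : proj.{w} 0 1 + proj 1 1 = 1 := by simpa [proj, e] using s_range_sum.{w}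
  have h0 := mono_conj_proj.{w} ⟨l, i⟩ 0 1
  have h1 := mono_conj_proj.{w} ⟨l, i⟩ 1 1
  simp only [mul_zero, add_zero, mul_one] at h0 h1
  rw [← h0, ← h1, ← add_mul, ← mul_add, h, mul_one, proj_eq]

theorem proj_mul_of_le (l : ℤ) {i j : ℕ} (h : i ≤ j) :
    proj.{w} l i * proj l j = proj l j := by
  have h1 := mono_conj_proj.{w} ⟨l, i⟩ 0 (j - i)
  simp only [mul_zero, add_zero, Nat.add_sub_cancel' h] at h1
  rw [← h1, proj_eq l i]
  simp only [← mul_assoc]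
  rw [mul_assoc (mono _) (star _) (mono _), star_mono_mul, mul_one]

theorem proj_mul_of_le' (l : ℤ) {i j : ℕ} (h : i ≤ j) :
    proj.{w} l j * proj l i = proj l j := by
  simpa only [star_mul, star_proj] using congrArg star (proj_mul_of_le.{w} l h)

theorem proj_mul_self (l : ℤ) (i : ℕ) : proj.{w} l i * proj l i = proj l i :=
  proj_mul_of_le l le_rfl

theorem proj_succ_mul_proj_succ (l : ℤ) (i : ℕ) :
    proj.{w} l (i + 1) * proj (l + 2 ^ i) (i + 1) = 0 := by
  have h := proj_mul_of_le'.{w} l i.le_succ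
  rw [proj_split l i, mul_add, proj_mul_self] at h
  exact add_eq_left.1 h

theorem proj_mul_proj_of_not_dvd {l n : ℤ} {i : ℕ} (h : ¬ (2 : ℤ) ^ i ∣ l - n) :
    proj.{w} l i * proj n i = 0 := by
  induction i with
  | zero => exact absurd (by simp) h
  | succ i ih =>
    by_cases hi : (2 : ℤ) ^ i ∣ l - n
    · obtain ⟨k, hk⟩ := hi
      rcases Int.even_or_odd' k with ⟨m, rfl | rfl⟩
      · exact absurd ⟨m, by rw [hk]; ring⟩ h
      · have hn : proj.{w} n (i + 1) = proj (l + 2 ^ i) (i + 1) :=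
          proj_congr ⟨-m - 1, by linear_combination -hk⟩
        rw [hn, proj_succ_mul_proj_succ]
    · rw [← proj_mul_of_le' l i.le_succ, ← proj_mul_of_le n i.le_succ, mul_assoc,
        ← mul_assoc (proj l i), ih hi, zero_mul, mul_zero]

/-- The projections multiply as the cosets `l + 2 ^ i ℤ₂` intersect. -/
theorem proj_mul_proj {l n : ℤ} {i j : ℕ} (h : i ≤ j) :
    proj.{w} l i * proj n j = if (2 : ℤ) ^ i ∣ l - n then proj n j else 0 := by
  split_ifs with hd
  · rw [proj_congr hd, proj_mul_of_le n h]
  · rw [← proj_mul_of_le n h, ← mul_assoc, proj_mul_proj_of_not_dvd hd, zero_mul]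

theorem proj_comm (l n : ℤ) (i j : ℕ) : proj.{w} l i * proj n j = proj n j * proj l i := by
  have key : ∀ {l n : ℤ} {i j : ℕ}, i ≤ j → proj.{w} l i * proj n j = proj n j * proj l i := by
    intro l n i j h
    have h1 := congrArg star (proj_mul_proj.{w} (l := l) (n := n) h)
    rw [proj_mul_proj h]
    rw [star_mul, star_proj, star_proj] at h1
    rw [h1]
    split_ifs <;> simp [star_proj]
  rcases le_total i j with h | h
  · exact key h
  · exact (key h).symm

theorem diag_mul_comm (a b : diag.{w}) : a * b = b * a := by
  set X : Set Q2.{w} := {x | ∃ l i, x = proj l i}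
  have h1 : diag.{w} ≤ StarSubalgebra.centralizer ℂ (StarSubalgebra.centralizer ℂ X) :=
    StarSubalgebra.topologicalClosure_adjoin_le_centralizer_centralizer ℂ X
  have h2 : X ⊆ StarSubalgebra.centralizer ℂ X := by
    rintro _ ⟨l, i, rfl⟩
    rw [SetLike.mem_coe, StarSubalgebra.mem_centralizer_iff]
    rintro _ ⟨n, j, rfl⟩
    rw [star_proj]
    exact ⟨proj_comm _ _ _ _, proj_comm _ _ _ _⟩
  have h3 := h1.trans (StarSubalgebra.centralizer_le ℂ _ _ h2)
  have h4 := h1.trans (StarSubalgebra.centralizer_le ℂ _ _ h3)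
  exact Subtype.ext (((StarSubalgebra.mem_centralizer_iff ℂ).1 (h4 b.2) a a.2).1)

/-- The diagonal subalgebra as a commutative C⋆-algebra. -/
@[reducible]
def diagCommCStarAlgebra : CommCStarAlgebra diag.{w} where
  mul_comm := diag_mul_comm

theorem proj_ne_zero (l : ℤ) (i : ℕ) : proj.{w} l i ≠ 0 := by
  intro h
  have h1 : star (mono ⟨l, i⟩) * proj.{w} l i * mono ⟨l, i⟩ = 1 := by
    rw [proj_eq, ← mul_assoc, star_mono_mul, one_mul, star_mono_mul]
  rw [h, mul_zero, zero_mul] at h1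
  exact zero_ne_one h1

theorem diagProj_ne_zero (l : ℤ) (i : ℕ) : diagProj.{w} l i ≠ 0 := fun h =>
  proj_ne_zero l i (congrArg Subtype.val h)

end Q2

/-! ### Cosets in the `2`-adic integers -/

namespace TwoAdic

theorem mem_coset_iff_dvd {l : ℤ} {i : ℕ} {z : ℤ_[2]} :
    z ∈ coset l i ↔ (2 : ℤ_[2]) ^ i ∣ z - l :=
  ⟨fun ⟨y, hy⟩ => ⟨y, by rw [hy]; ring⟩, fun ⟨y, hy⟩ => ⟨y, by rw [← hy]; ring⟩⟩

theorem two_pow_dvd_intCast_iff {n : ℤ} {i : ℕ} : (2 : ℤ_[2]) ^ i ∣ n ↔ (2 : ℤ) ^ i ∣ n := by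
  simpa using PadicInt.pow_p_dvd_int_iff (p := 2) i n

theorem mem_coset_iff_of_mem {l n : ℤ} {i : ℕ} {z : ℤ_[2]} (hz : z ∈ coset l i) :
    z ∈ coset n i ↔ (2 : ℤ) ^ i ∣ l - n := by
  rw [mem_coset_iff_dvd] at hz ⊢
  rw [← two_pow_dvd_intCast_iff, Int.cast_sub, ← sub_add_sub_cancel z l n, dvd_add_right hz]

theorem coset_subset {l n : ℤ} {i j : ℕ} (hij : i ≤ j) (h : (2 : ℤ) ^ i ∣ n - l) :
    coset n j ⊆ coset l i := by
  intro z hz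
  rw [mem_coset_iff_dvd] at hz ⊢
  rw [← two_pow_dvd_intCast_iff, Int.cast_sub] at h
  simpa using dvd_add ((pow_dvd_pow _ hij).trans hz) h

theorem exists_mem_coset (z : ℤ_[2]) (i : ℕ) : ∃ l : ℤ, z ∈ coset l i := by
  refine ⟨z.appr i, mem_coset_iff_dvd.2 ?_⟩
  simpa [Ideal.mem_span_singleton] using PadicInt.appr_spec i z

theorem dist_le_of_mem_coset {l : ℤ} {i : ℕ} {x z : ℤ_[2]} (hx : x ∈ coset l i)
    (hz : z ∈ coset l i) : dist x z ≤ (2 : ℝ) ^ (-i : ℤ) := by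
  rw [mem_coset_iff_dvd] at hx hz
  have h : (2 : ℤ_[2]) ^ i ∣ x - z := by simpa using dvd_sub hx hz
  rw [dist_eq_norm]
  have h1 := PadicInt.norm_le_pow_iff_mem_span_pow (p := 2) (x - z) i
  rw [Ideal.mem_span_singleton] at h1
  push_cast at h1
  exact h1.2 h

theorem exists_two_zpow_neg_lt {ε : ℝ} (hε : 0 < ε) : ∃ i : ℕ, (2 : ℝ) ^ (-i : ℤ) < ε := by
  obtain ⟨i, hi⟩ := exists_pow_lt_of_lt_one hε (by norm_num : (1 / 2 : ℝ) < 1)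
  exact ⟨i, by simpa using hi⟩

theorem indicator_of_mem {l : ℤ} {i : ℕ} {z : ℤ_[2]} (hz : z ∈ coset l i) :
    indicator l i z = 1 := Set.indicator_of_mem hz _

theorem indicator_of_notMem {l : ℤ} {i : ℕ} {z : ℤ_[2]} (hz : z ∉ coset l i) :
    indicator l i z = 0 := Set.indicator_of_notMem hz _

theorem aff_mem_coset_iff (p q : AffSemigroup) (y : ℤ_[2]) :
    aff p y ∈ coset (p * q).l (p * q).i ↔ y ∈ coset q.l q.i := by
  rw [← range_aff (p * q), ← range_aff q]
  constructor
  · rintro ⟨x, hx⟩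
    rw [aff_mul] at hx
    exact ⟨x, aff_injective p hx⟩
  · rintro ⟨x, rfl⟩
    exact ⟨x, aff_mul p q x⟩

theorem coset_mul_subset (p q : AffSemigroup) :
    coset (p * q).l (p * q).i ⊆ coset p.l p.i := by
  rw [← range_aff (p * q), ← range_aff p]
  rintro _ ⟨x, rfl⟩
  exact ⟨aff q x, (aff_mul p q x).symm⟩

theorem affAction_indicator (p q : AffSemigroup) :
    affAction p (indicator q.l q.i) = indicator (p * q).l (p * q).i := by
  ext z
  change affFun p (indicator q.l q.i) z = _
  refine affFun_ext p (g := affFun p (indicator q.l q.i)) (fun y => ?_) (fun z hz => ?_) z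
  · rw [affFun_aff]
    by_cases hy : y ∈ coset q.l q.i
    · rw [indicator_of_mem hy, indicator_of_mem ((aff_mem_coset_iff p q y).2 hy)]
    · rw [indicator_of_notMem hy, indicator_of_notMem fun h => hy ((aff_mem_coset_iff p q y).1 h)]
  · rw [affFun_of_notMem p _ hz, indicator_of_notMem fun h => hz (coset_mul_subset p q h)]

end TwoAdic

/-! ### The spectrum of the diagonal subalgebra -/

namespace Q2

open WeakDual TwoAdic

attribute [local instance] diagCommCStarAlgebra

theorem exists_character_diagProj_eq_one (χ : characterSpace ℂ diag.{w}) (i : ℕ) :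
    ∃ l, χ (diagProj l i) = 1 := by
  induction i with
  | zero =>
    refine ⟨0, ?_⟩
    rw [show diagProj.{w} 0 0 = 1 from Subtype.ext (proj_zero 0), map_one]
  | succ i ih =>
    obtain ⟨l, hl⟩ := ih
    rw [show diagProj.{w} l i = diagProj l (i + 1) + diagProj (l + 2 ^ i) (i + 1) from
      Subtype.ext (proj_split l i), map_add] at hl
    have h : χ (diagProj l (i + 1)) * χ (diagProj l (i + 1)) = χ (diagProj l (i + 1)) := by
      rw [← map_mul]
      exact congrArg χ (Subtype.ext (proj_mul_self l (i + 1)))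
    rcases (IsIdempotentElem.iff_eq_zero_or_one.1 h) with h0 | h1
    · exact ⟨_, by rwa [h0, zero_add] at hl⟩
    · exact ⟨_, h1⟩

theorem character_diagProj_mul (χ : characterSpace ℂ diag.{w}) {l n : ℤ} {i j : ℕ} (h : i ≤ j) :
    χ (diagProj l i) * χ (diagProj n j) =
      if (2 : ℤ) ^ i ∣ l - n then χ (diagProj n j) else 0 := by
  rw [← map_mul]
  split_ifs with hd
  · refine congrArg χ (Subtype.ext ?_)
    exact (proj_mul_proj h).trans (if_pos hd)
  · rw [← map_zero χ]
    refine congrArg χ (Subtype.ext ?_)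
    exact (proj_mul_proj h).trans (if_neg hd)

/-- A character of the diagonal subalgebra is the evaluation at a `2`-adic integer: the cosets whose
projections it maps to `1` are nested, and the integer is their common point. -/
theorem exists_character_eq_indicator (χ : characterSpace ℂ diag.{w}) :
    ∃ z : ℤ_[2], ∀ l i, χ (diagProj l i) = indicator l i z := by
  choose a ha using exists_character_diagProj_eq_one χ
  have hmul : ∀ l {i j}, i ≤ j → χ (diagProj l i) = if (2 : ℤ) ^ i ∣ l - a j then 1 else 0 := by
    intro l i j h
    simpa only [ha, mul_one] using character_diagProj_mul χ (l := l) (n := a j) h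
  have hnest : ∀ i, coset (a (i + 1)) (i + 1) ⊆ coset (a i) i := by
    intro i
    refine coset_subset i.le_succ ?_
    have h := hmul (a i) i.le_succ
    rw [ha] at h
    rw [dvd_sub_comm]
    by_contra hd
    rw [if_neg hd] at h
    exact one_ne_zero h
  obtain ⟨z, hz⟩ := IsCompact.nonempty_iInter_of_sequence_nonempty_isCompact_isClosed
    (fun i => coset (a i) i) hnest (fun i => ⟨a i, 0, by simp⟩)
    (isClopen_coset _ _).isClosed.isCompact (fun i => (isClopen_coset _ _).isClosed)
  refine ⟨z, fun l i => ?_⟩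
  have h1 := mem_coset_iff_of_mem (n := l) (Set.mem_iInter.1 hz i)
  rw [hmul l le_rfl]
  split_ifs with hd
  · rw [indicator_of_mem]
    rwa [h1, dvd_sub_comm]
  · rw [indicator_of_notMem]
    rwa [h1, dvd_sub_comm]

/-- The `2`-adic integer at which a character of the diagonal subalgebra evaluates. -/
def point (χ : characterSpace ℂ diag.{w}) : ℤ_[2] := (exists_character_eq_indicator χ).choose

theorem character_diagProj (χ : characterSpace ℂ diag.{w}) (l : ℤ) (i : ℕ) :
    χ (diagProj l i) = indicator l i (point χ) :=
  (exists_character_eq_indicator χ).choose_spec l i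

theorem point_mem_coset_iff (χ : characterSpace ℂ diag.{w}) (l : ℤ) (i : ℕ) :
    point χ ∈ coset l i ↔ χ (diagProj l i) ≠ 0 := by
  rw [character_diagProj]
  by_cases h : point χ ∈ coset l i
  · simp [h, indicator_of_mem h]
  · simp [h, indicator_of_notMem h]

theorem continuous_point : Continuous point.{w} := by
  refine Metric.continuous_iff'.2 fun χ ε hε => ?_
  obtain ⟨i, hi⟩ := exists_two_zpow_neg_lt hε
  obtain ⟨l, hl⟩ := exists_mem_coset (point χ) i
  have hc : Continuous fun ψ : characterSpace ℂ diag.{w} => ψ (diagProj l i) :=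
    (WeakDual.eval_continuous _).comp continuous_subtype_val
  filter_upwards [(isOpen_ne.preimage hc).mem_nhds ((point_mem_coset_iff χ l i).1 hl)] with ψ hψ
  exact (dist_le_of_mem_coset ((point_mem_coset_iff ψ l i).2 hψ) hl).trans_lt hi

theorem point_injective : Function.Injective point.{w} := by
  intro χ ψ h
  refine Subtype.ext (DFunLike.ext _ _ fun x => ?_)
  have hle : ∀ x ∈ (StarAlgebra.adjoin ℂ
      {x : diag.{w} | ∃ l i, x = diagProj l i}).topologicalClosure, χ x = ψ x := by
    intro x hx
    refine StarAlgHom.eqOn_topologicalClosure_adjoin (f := (χ : diag.{w} →⋆ₐ[ℂ] ℂ))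
      (g := (ψ : diag.{w} →⋆ₐ[ℂ] ℂ)) ?_ hx
    rintro _ ⟨l, i, rfl⟩
    change χ (diagProj l i) = ψ (diagProj l i)
    rw [character_diagProj, character_diagProj, h]
  exact hle x (by rw [topologicalClosure_adjoin_range_diagProj]; trivial)

/-- The image of the spectrum is compact, and dense because the projections are nonzero. -/
theorem point_surjective : Function.Surjective point.{w} := by
  intro z
  have hcl : IsClosed (Set.range point.{w}) := (isCompact_range continuous_point).isClosed
  rw [← Set.mem_range, ← hcl.closure_eq]
  refine Metric.mem_closure_iff.2 fun ε hε => ?_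
  obtain ⟨i, hi⟩ := exists_two_zpow_neg_lt hε
  obtain ⟨l, hl⟩ := exists_mem_coset z i
  obtain ⟨χ, hχ⟩ : ∃ χ : characterSpace ℂ diag.{w}, χ (diagProj l i) ≠ 0 := by
    by_contra! h
    refine diagProj_ne_zero l i ((gelfandTransform_isometry diag.{w}).injective ?_)
    rw [map_zero]
    exact ContinuousMap.ext h
  exact ⟨_, ⟨χ, rfl⟩, (dist_le_of_mem_coset hl ((point_mem_coset_iff χ l i).2 hχ)).trans_lt hi⟩

/-- The homeomorphism from `ℤ₂` onto the spectrum of the diagonal subalgebra. -/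
def spectrumHomeomorph : ℤ_[2] ≃ₜ characterSpace ℂ diag.{w} :=
  (continuous_point.homeoOfEquivCompactToT2
    (f := Equiv.ofBijective point ⟨point_injective, point_surjective⟩)).symm

theorem point_spectrumHomeomorph (z : ℤ_[2]) : point (spectrumHomeomorph.{w} z) = z :=
  (Equiv.ofBijective point.{w} ⟨point_injective, point_surjective⟩).apply_symm_apply z

/-- The Gelfand transform of the diagonal subalgebra, as a function on `ℤ₂`. -/
def gelfand : diag.{w} ≃⋆ₐ[ℂ] C(ℤ_[2], ℂ) :=
  (gelfandStarTransform diag.{w}).trans (spectrumHomeomorph.{w}.compStarAlgEquiv' ℂ ℂ)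

theorem gelfand_apply (a : diag.{w}) (z : ℤ_[2]) : gelfand a z = spectrumHomeomorph z a := rfl

theorem gelfand_diagProj (l : ℤ) (i : ℕ) : gelfand (diagProj.{w} l i) = indicator l i := by
  ext z
  rw [gelfand_apply, character_diagProj, point_spectrumHomeomorph]

theorem gelfand_diagAction (p : AffSemigroup) (a : diag.{w}) :
    gelfand (diagAction p a) = affAction p (gelfand a) := by
  have key (l : ℤ) (i : ℕ) :
      gelfand (diagAction p (diagProj.{w} l i)) = affAction p (gelfand (diagProj l i)) := by
    rw [diagAction_diagProj, gelfand_diagProj, gelfand_diagProj]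
    exact (affAction_indicator p ⟨l, i⟩).symm
  refine NonUnitalStarAlgHom.eqOn_topologicalClosure_adjoin
    (X := {x : diag.{w} | ∃ l i, x = diagProj l i})
    (f := (gelfand.{w} : diag.{w} →⋆ₙₐ[ℂ] C(ℤ_[2], ℂ)).comp (diagAction p))
    (g := (affAction p).comp (gelfand.{w} : diag.{w} →⋆ₙₐ[ℂ] C(ℤ_[2], ℂ))) ?_ ?_
    (x := a) (by rw [topologicalClosure_adjoin_range_diagProj]; trivial)
  · rintro _ ⟨l, i, rfl⟩
    exact key l i
  · rw [show (1 : diag.{w}) = diagProj 0 0 from Subtype.ext (proj_zero 0).symm]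
    exact key 0 0

end Q2

end

/-- The diagonal subalgebra `𝒟` of `Q₂` is commutative, it is equivariantly isomorphic to `C(ℤ₂)` by
the Gelfand transform, and `Q₂` is the semigroup crossed product of `𝒟`, and of `C(ℤ₂)`, by
`ℤ ⋊ [2⟩`. The universes are those of the Hilbert spaces used to build the universal C⋆-algebras. -/
theorem corollary5p4 :
    -- `𝒟` is commutative
    (∀ a b : Q2.diag.{w}, a * b = b * a) ∧
    -- the Gelfand transform of `𝒟`, through a homeomorphism of `ℤ₂` with the spectrum of `𝒟`
    (∃ (σ : ℤ_[2] ≃ₜ WeakDual.characterSpace ℂ Q2.diag.{w}) (Γ : Q2.diag.{w} ≃⋆ₐ[ℂ] C(ℤ_[2], ℂ)),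
      (∀ a z, Γ a z = σ z a) ∧
      (∀ l i, Γ (Q2.diagProj l i) = TwoAdic.indicator l i) ∧
      (∀ p a, Γ (Q2.diagAction p a) = TwoAdic.affAction p (Γ a))) ∧
    -- `Q₂` is the crossed product of `𝒟`
    (∃ Φ : Q2.{w} ≃⋆ₐ[ℂ] SemigroupCrossedProduct.{w + 1, 0, w₁} Q2.diagAction.{w},
      ∀ (l : ℤ) (i : ℕ), Φ (((Q2.u ^ l : unitary Q2.{w}) : Q2.{w}) * Q2.s ^ i) =
        SemigroupCrossedProduct.isom Q2.diagAction ⟨l, i⟩) ∧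
    -- `Q₂` is the crossed product of `C(ℤ₂)`; here `⟨0, 1⟩ = (0, 2)` and `⟨1, 0⟩ = (1, 1)`
    (∃ Ψ : Q2.{w} ≃⋆ₐ[ℂ] SemigroupCrossedProduct.{0, 0, w₂} TwoAdic.affAction,
      Ψ Q2.s = SemigroupCrossedProduct.isom TwoAdic.affAction ⟨0, 1⟩ ∧
      Ψ (Q2.u : Q2.{w}) = SemigroupCrossedProduct.isom TwoAdic.affAction ⟨1, 0⟩) := by
  refine ⟨Q2.diag_mul_comm, ⟨Q2.spectrumHomeomorph, Q2.gelfand, Q2.gelfand_apply,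
    Q2.gelfand_diagProj, Q2.gelfand_diagAction⟩, ?_, ?_⟩
  · obtain ⟨Φ, hΦ⟩ := Q2.exists_starAlgEquiv_crossedProduct.{w + 1, w, w₁}
      (α := Q2.diagAction) (StarAlgEquiv.refl ℂ Q2.diag.{w}) fun _ _ => rfl
    exact ⟨Φ, fun l i => hΦ ⟨l, i⟩⟩
  · obtain ⟨Ψ, hΨ⟩ := Q2.exists_starAlgEquiv_crossedProduct.{0, w, w₂}
      Q2.gelfand Q2.gelfand_diagAction
    refine ⟨Ψ, ?_, ?_⟩
    · rw [← hΨ, Q2.mono_zero_one]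
    · rw [← hΨ, Q2.mono_one_zero]
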